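/- Let $d\ge 0$, $r\ge 0$, $c\ge 1$ be integers, $V=\mathbb{C}^c$, $W=\mathbb{C}^r$, and let $(z_0:\dots:z_d:x:y)$ be homogeneous coordinates on $\mathbb{P}^{d+2}$ over $\mathbb{C}$. An ADHM datum of charge $c$ is a tuple $X=(A_k,B_k,I_k,J_k)_{0\le k\le d}$ with $A_k,B_k\in\mathrm{End}(V)$, $I_k\in\mathrm{Hom}(W,V)$, $J_k\in\mathrm{Hom}(V,W)$; write $A=\sum_k A_kz_k$, and similarly $B$, $I$, $J$. The datum is a solution of the ADHM equation if $[A,B]+IJ=0$ identically in $z_0,\dots,z_d$. It is globally stable if for every point $P=(p_0:\dots:p_d:x:y)\in\mathbb{P}^{d+2}$ with $(p_0,\dots,p_d)\ne 0$ there is no proper subspace $S\subsetneq V$ that is invariant under $A_P=\sum_k p_kA_k$ and $B_P=\sum_k p_kB_k$ and contains the image of $I_P=\sum_k p_kI_k$. The group $GL(V)$ acts by $g\cdot(A,B,I,J)=(gAg^{-1},gBg^{-1},gI,Jg^{-1})$. Let $\mathcal{M}_d^{\rm gs}(r,c)$ be the set of orbits of globally stable solutions with its quotient structure: the quotient of the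 Zariski topology, a function on an open set being regular if and only if its pull-back to the space of globally stable solutions is regular. **Proposition (charge one).** If $r\le d$, then $\mathcal{M}_d^{\rm gs}(r,1)$ is empty. If $r>d$, then $\mathcal{M}_d^{\rm gs}(r,1)$ is a nonsingular (irreducible) quasi-projective variety of dimension $$2(d+1)r-\tfrac12 d(d-1).$$ Moreover, in this case let $\mathbb{P}(1,\dots,1,-1,\dots,-1)$, with $(d+1)r$ weights of each sign, be the quotient of $\mathbb{C}^{2(d+1)r}\setminus\{0\}$ by the action $t\cdot(I,J)=(tI,t^{-1}J)$ of $\mathbb{C}^*$, where $I=(I_k)_{0\le k\le d}$, $J=(J_k)_{0\le k\le d}$ with $I_k,J_k\in\mathbb{C}^r$, and let $\mathcal{B}(d,r)$ be the set of solutions $[I,J]$ in it of the equations $$I_kJ_k=0\quad(0\le k\le d),\qquad I_kJ_m+I_mJ_k=0\quad(0\le k<m\le d)$$ for which $I_0,\dots,I_d$ are linearly independent. Then $\mathcal{B}(d,r)$ is an open subset of the set of all solutions of these equations in $\mathbb{P}(1,\dots,1,-1,\dots,-1)$, and $[A,B,I,J]\mapsto\big((A_k,B_k)_k,[I,J]\big)$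 is an isomorphism $$\mathcal{M}_d^{\rm gs}(r,1)\;\cong\;\mathbb{C}^{2(d+1)}\times\mathcal{B}(d,r).$$ -/

import Mathlib

open Filter Topology

noncomputable section

/-- A *space with functions* over `ℂ` (the classical language for algebraic varieties): a topological
space in which every point `x` has a class of complex-valued functions that are regular at `x`.
Regularity depends only on the germ, regular functions form a `ℂ`-algebra, the locus where a function
is regular is open, and a function which is regular and nonzero at `x` is nonzero near `x` and has
a regular inverse. The regular functions on an open set `U` are those regular at each point of `U`. -/
structure SpaceWithFunctions where
  carrier : Type
  topology : TopologicalSpace carrier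
  IsRegularAt : (carrier → ℂ) → carrier → Prop
  congr_germ : ∀ {f g : carrier → ℂ} {x : carrier}, f =ᶠ[𝓝 x] g → IsRegularAt f x → IsRegularAt g x
  const : ∀ (a : ℂ) (x : carrier), IsRegularAt (fun _ => a) x
  add : ∀ {f g : carrier → ℂ} {x : carrier}, IsRegularAt f x → IsRegularAt g x → IsRegularAt (f + g) x
  mul : ∀ {f g : carrier → ℂ} {x : carrier}, IsRegularAt f x → IsRegularAt g x → IsRegularAt (f * g) x
  eventually : ∀ {f : carrier → ℂ} {x : carrier}, IsRegularAt f x → ∀ᶠ y in 𝓝 x, IsRegularAt f y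
  inv : ∀ {f : carrier → ℂ} {x : carrier}, IsRegularAt f x → f x ≠ 0 →
    (∀ᶠ y in 𝓝 x, f y ≠ 0) ∧ IsRegularAt f⁻¹ x

namespace SpaceWithFunctions

attribute [instance] SpaceWithFunctions.topology

/-- An isomorphism of spaces with functions: a homeomorphism which, in both directions, carries
regular functions to regular functions. -/
structure Iso (X Y : SpaceWithFunctions) where
  toHomeomorph : X.carrier ≃ₜ Y.carrier
  regular_iff : ∀ (f : Y.carrier → ℂ) (x : X.carrier),
    X.IsRegularAt (fun z => f (toHomeomorph z)) x ↔ Y.IsRegularAt f (toHomeomorph x)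

/-- The local ring of a space with functions at a point: the ring of germs of regular functions. -/
def localRing (X : SpaceWithFunctions) (x : X.carrier) : Subring (Germ (𝓝 x) ℂ) where
  carrier := {g | ∃ f : X.carrier → ℂ, X.IsRegularAt f x ∧ (f : Germ (𝓝 x) ℂ) = g}
  zero_mem' := ⟨_, X.const 0 x, rfl⟩
  one_mem' := ⟨_, X.const 1 x, rfl⟩
  add_mem' := by
    rintro _ _ ⟨f, hf, rfl⟩ ⟨g, hg, rfl⟩
    exact ⟨_, X.add hf hg, rfl⟩
  mul_mem' := by
    rintro _ _ ⟨f, hf, rfl⟩ ⟨g, hg, rfl⟩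
    exact ⟨_, X.mul hf hg, rfl⟩
  neg_mem' := by
    rintro _ ⟨f, hf, rfl⟩
    refine ⟨_, X.mul (X.const (-1) x) hf, ?_⟩
    rw [← Germ.coe_neg]
    congr 1
    funext y
    simp

/-- Nonsingularity: every local ring is a regular local ring. -/
def IsNonsingular (X : SpaceWithFunctions) : Prop :=
  ∀ x : X.carrier, IsRegularLocalRing (X.localRing x)

/-! ### Affine space -/

/-- The polynomial functions on a complex vector space: the algebra generated by the linear forms. -/
def polynomialFunctions (V : Type) [AddCommGroup V] [Module ℂ V] : Subalgebra ℂ (V → ℂ) :=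
  Algebra.adjoin ℂ {f | ∃ l : V →ₗ[ℂ] ℂ, f = fun v => l v}

/-- The Zariski topology on a (finite dimensional) complex vector space. -/
@[reducible] def zariskiTopology (V : Type) [AddCommGroup V] [Module ℂ V] : TopologicalSpace V :=
  TopologicalSpace.generateFrom {U | ∃ p ∈ polynomialFunctions V, U = {v | p v ≠ 0}}

lemma zariski_eventually {V : Type} [AddCommGroup V] [Module ℂ V] {p : V → ℂ}
    (hp : p ∈ polynomialFunctions V) {v : V} (hv : p v ≠ 0) :
    ∀ᶠ y in @nhds _ (zariskiTopology V) v, p y ≠ 0 := by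
  let _ : TopologicalSpace V := zariskiTopology V
  have ho : IsOpen {v : V | p v ≠ 0} :=
    TopologicalSpace.isOpen_generateFrom_of_mem ⟨p, hp, rfl⟩
  exact ho.mem_nhds hv

/-- A (finite dimensional) complex vector space as an affine space: the Zariski topology, and regular
functions are locally quotients of polynomial functions. -/
def affineSpace (V : Type) [AddCommGroup V] [Module ℂ V] : SpaceWithFunctions :=
  letI : TopologicalSpace V := zariskiTopology V
  have op : ∀ p ∈ polynomialFunctions V, ∀ v : V, p v ≠ 0 → ∀ᶠ y in 𝓝 v, p y ≠ 0 :=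
    fun _ hp _ hv => zariski_eventually hp hv
  { carrier := V
    topology := zariskiTopology V
    IsRegularAt := fun f v => ∃ p ∈ polynomialFunctions V, ∃ q ∈ polynomialFunctions V,
      q v ≠ 0 ∧ f =ᶠ[𝓝 v] fun y => p y / q y
    congr_germ := by
      rintro f g v hfg ⟨p, hp, q, hq, hv, h⟩
      exact ⟨p, hp, q, hq, hv, hfg.symm.trans h⟩
    const := fun a v => ⟨fun _ => a, (polynomialFunctions V).algebraMap_mem a, 1, one_mem _, by simp,
      Eventually.of_forall fun y => by simp⟩
    add := by
      rintro f g v ⟨p, hp, q, hq, hv, h⟩ ⟨p', hp', q', hq', hv', h'⟩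
      refine ⟨p * q' + q * p', add_mem (mul_mem hp hq') (mul_mem hq hp'), q * q', mul_mem hq hq',
        mul_ne_zero hv hv', ?_⟩
      filter_upwards [h, h', op q hq v hv, op q' hq' v hv'] with y h1 h2 h3 h4
      simp only [Pi.add_apply, Pi.mul_apply, h1, h2]
      rw [div_add_div _ _ h3 h4]
    mul := by
      rintro f g v ⟨p, hp, q, hq, hv, h⟩ ⟨p', hp', q', hq', hv', h'⟩
      refine ⟨p * p', mul_mem hp hp', q * q', mul_mem hq hq', mul_ne_zero hv hv', ?_⟩
      filter_upwards [h, h'] with y h1 h2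
      simp only [Pi.mul_apply, h1, h2]
      rw [div_mul_div_comm]
    eventually := by
      rintro f v ⟨p, hp, q, hq, hv, h⟩
      filter_upwards [op q hq v hv, h.eventually_nhds] with y h1 h2
      exact ⟨p, hp, q, hq, h1, h2⟩
    inv := by
      rintro f v ⟨p, hp, q, hq, hv, h⟩ hf
      have hpv : p v ≠ 0 := by
        intro h0
        apply hf
        rw [h.eq_of_nhds, h0, zero_div]
      refine ⟨?_, q, hq, p, hp, hpv, ?_⟩
      · filter_upwards [op q hq v hv, op p hp v hpv, h] with y h1 h2 h3
        rw [h3]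
        exact div_ne_zero h2 h1
      · filter_upwards [h] with y h3
        rw [Pi.inv_apply, h3, inv_div] }

/-! ### Subspaces and quotients -/

/-- A subset with the induced structure: the subspace topology, and the functions that are locally
restrictions of regular functions. -/
def restrict (X : SpaceWithFunctions) (S : Set X.carrier) : SpaceWithFunctions where
  carrier := S
  topology := inferInstance
  IsRegularAt := fun f x => ∃ F : X.carrier → ℂ, X.IsRegularAt F x ∧ f =ᶠ[𝓝 x] fun y => F y
  congr_germ := by
    rintro f g x hfg ⟨F, hF, h⟩
    exact ⟨F, hF, hfg.symm.trans h⟩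
  const := fun a x => ⟨_, X.const a x, EventuallyEq.rfl⟩
  add := by
    rintro f g x ⟨F, hF, h⟩ ⟨G, hG, h'⟩
    exact ⟨_, X.add hF hG, h.add h'⟩
  mul := by
    rintro f g x ⟨F, hF, h⟩ ⟨G, hG, h'⟩
    exact ⟨_, X.mul hF hG, h.mul h'⟩
  eventually := by
    rintro f x ⟨F, hF, h⟩
    filter_upwards [continuous_subtype_val.continuousAt.eventually (X.eventually hF),
      h.eventually_nhds] with y h1 h2
    exact ⟨F, h1, h2⟩
  inv := by
    rintro f x ⟨F, hF, h⟩ hx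
    have hFx : F x ≠ 0 := by rwa [← h.eq_of_nhds]
    obtain ⟨h1, h2⟩ := X.inv hF hFx
    refine ⟨?_, _, h2, h.inv⟩
    filter_upwards [h, continuous_subtype_val.continuousAt.eventually h1] with y h3 h4
    rwa [h3]

/-- The quotient by an equivalence relation: the quotient topology, and a function is regular on an
open set if and only if its pull-back is regular on the preimage of this open set. For an orbit
relation this is the structure of a geometric quotient. -/
def quotient (X : SpaceWithFunctions) (s : Setoid X.carrier) : SpaceWithFunctions where
  carrier := Quotient s
  topology := inferInstance
  IsRegularAt := fun f q => ∀ᶠ q' in 𝓝 q, ∀ x : X.carrier, Quotient.mk s x = q' →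
    X.IsRegularAt (fun y => f (Quotient.mk s y)) x
  congr_germ := by
    intro f g q hfg h
    filter_upwards [hfg.eventually_nhds, h] with q' h1 h2 x hx
    subst hx
    exact X.congr_germ (continuous_quotient_mk'.continuousAt.eventually h1) (h2 x rfl)
  const := fun a q => Eventually.of_forall fun _ x _ => X.const a x
  add := by
    intro f g q hf hg
    filter_upwards [hf, hg] with q' h1 h2 x hx
    exact X.add (h1 x hx) (h2 x hx)
  mul := by
    intro f g q hf hg
    filter_upwards [hf, hg] with q' h1 h2 x hx
    exact X.mul (h1 x hx) (h2 x hx)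
  eventually := fun h => h.eventually_nhds
  inv := by
    intro f q hf hq
    obtain ⟨U, hU, hUo, hqU⟩ := eventually_nhds_iff.1 hf
    have ho : IsOpen {q' | q' ∈ U ∧ f q' ≠ 0} := by
      rw [← isQuotientMap_quotient_mk'.isOpen_preimage, isOpen_iff_mem_nhds]
      rintro x ⟨hx, hfx⟩
      have h1 := (X.inv (hU _ hx x rfl) hfx).1
      filter_upwards [h1, continuous_quotient_mk'.continuousAt.preimage_mem_nhds
        (hUo.mem_nhds hx)] with y h2 h3
      exact ⟨h3, h2⟩
    have hn := ho.mem_nhds (show q ∈ {q' | q' ∈ U ∧ f q' ≠ 0} from ⟨hqU, hq⟩)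
    refine ⟨?_, ?_⟩
    · filter_upwards [hn] with q' h using h.2
    · filter_upwards [hn] with q' h x hx
      subst hx
      exact (X.inv (hU _ h.1 x rfl) h.2).2

/-! ### Products -/

/-- The functions `∑ fᵢ(x) gᵢ(y)` with `fᵢ` regular on `U` and `gᵢ` regular on `V`. -/
def tensorFunctions (X Y : SpaceWithFunctions) (U : Set X.carrier) (V : Set Y.carrier) :
    Subalgebra ℂ (X.carrier × Y.carrier → ℂ) :=
  Algebra.adjoin ℂ ({h | ∃ f : X.carrier → ℂ, (∀ x ∈ U, X.IsRegularAt f x) ∧ h = fun p => f p.1} ∪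
    {h | ∃ g : Y.carrier → ℂ, (∀ y ∈ V, Y.IsRegularAt g y) ∧ h = fun p => g p.2})

/-- The basic open sets of the product of two spaces with functions. -/
def prodBasis (X Y : SpaceWithFunctions) : Set (Set (X.carrier × Y.carrier)) :=
  {D | ∃ (U : Set X.carrier) (V : Set Y.carrier), IsOpen U ∧ IsOpen V ∧
    ∃ h ∈ tensorFunctions X Y U V, D = {p | p.1 ∈ U ∧ p.2 ∈ V ∧ h p ≠ 0}}

/-- The topology of the product of two spaces with functions (finer than the product topology:
on a product of affine spaces it is the Zariski topology). -/
@[reducible] def prodTopology (X Y : SpaceWithFunctions) : TopologicalSpace (X.carrier × Y.carrier) :=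
  TopologicalSpace.generateFrom (prodBasis X Y)

lemma tensorFunctions_mono (X Y : SpaceWithFunctions) {U U' : Set X.carrier} {V V' : Set Y.carrier}
    (hU : U' ⊆ U) (hV : V' ⊆ V) : tensorFunctions X Y U V ≤ tensorFunctions X Y U' V' := by
  apply Algebra.adjoin_mono
  rintro h (⟨f, hf, rfl⟩ | ⟨g, hg, rfl⟩)
  · exact Or.inl ⟨f, fun x hx => hf x (hU hx), rfl⟩
  · exact Or.inr ⟨g, fun y hy => hg y (hV hy), rfl⟩

lemma prod_eventually (X Y : SpaceWithFunctions) {U : Set X.carrier} {V : Set Y.carrier}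
    (hU : IsOpen U) (hV : IsOpen V) {h : X.carrier × Y.carrier → ℂ}
    (hh : h ∈ tensorFunctions X Y U V) {p : X.carrier × Y.carrier} (h1 : p.1 ∈ U) (h2 : p.2 ∈ V)
    (h3 : h p ≠ 0) : ∀ᶠ q in @nhds _ (prodTopology X Y) p, q.1 ∈ U ∧ q.2 ∈ V ∧ h q ≠ 0 := by
  have ho : @IsOpen _ (prodTopology X Y) {q : X.carrier × Y.carrier | q.1 ∈ U ∧ q.2 ∈ V ∧ h q ≠ 0} :=
    TopologicalSpace.isOpen_generateFrom_of_mem ⟨U, V, hU, hV, h, hh, rfl⟩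
  exact @IsOpen.mem_nhds _ (prodTopology X Y) _ _ ho ⟨h1, h2, h3⟩

/-- The product of two spaces with functions: regular functions are locally of the form
`(∑ fᵢ(x) gᵢ(y)) / (∑ fⱼ'(x) gⱼ'(y))` with regular `fᵢ, gᵢ, fⱼ', gⱼ'`. -/
def prod (X Y : SpaceWithFunctions) : SpaceWithFunctions where
  carrier := X.carrier × Y.carrier
  topology := prodTopology X Y
  IsRegularAt := fun f p => ∃ (U : Set X.carrier) (V : Set Y.carrier), IsOpen U ∧ IsOpen V ∧
    p.1 ∈ U ∧ p.2 ∈ V ∧ ∃ h ∈ tensorFunctions X Y U V, ∃ k ∈ tensorFunctions X Y U V,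
      k p ≠ 0 ∧ ∀ᶠ q in @nhds _ (prodTopology X Y) p, f q = h q / k q
  congr_germ := by
    rintro f g p hfg ⟨U, V, hU, hV, h1, h2, h, hh, k, hk, hp, he⟩
    refine ⟨U, V, hU, hV, h1, h2, h, hh, k, hk, hp, ?_⟩
    filter_upwards [hfg, he] with q h3 h4
    rw [← h3, h4]
  const := fun a p => ⟨Set.univ, Set.univ, isOpen_univ, isOpen_univ, trivial, trivial, fun _ => a,
    (tensorFunctions X Y _ _).algebraMap_mem a, 1, one_mem _, by simp,
    Eventually.of_forall fun y => by simp⟩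
  add := by
    rintro f g p ⟨U, V, hU, hV, h1, h2, h, hh, k, hk, hp, he⟩
      ⟨U', V', hU', hV', h1', h2', h', hh', k', hk', hp', he'⟩
    have m1 := tensorFunctions_mono X Y (U := U) (V := V) (U' := U ∩ U') (V' := V ∩ V')
      Set.inter_subset_left Set.inter_subset_left
    have m2 := tensorFunctions_mono X Y (U := U') (V := V') (U' := U ∩ U') (V' := V ∩ V')
      Set.inter_subset_right Set.inter_subset_right
    refine ⟨U ∩ U', V ∩ V', hU.inter hU', hV.inter hV', ⟨h1, h1'⟩, ⟨h2, h2'⟩, h * k' + k * h',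
      add_mem (mul_mem (m1 hh) (m2 hk')) (mul_mem (m1 hk) (m2 hh')), k * k',
      mul_mem (m1 hk) (m2 hk'), mul_ne_zero hp hp', ?_⟩
    filter_upwards [he, he', prod_eventually X Y hU hV hk h1 h2 hp,
      prod_eventually X Y hU' hV' hk' h1' h2' hp'] with q e e' n n'
    simp only [Pi.add_apply, Pi.mul_apply, e, e']
    rw [div_add_div _ _ n.2.2 n'.2.2]
  mul := by
    rintro f g p ⟨U, V, hU, hV, h1, h2, h, hh, k, hk, hp, he⟩
      ⟨U', V', hU', hV', h1', h2', h', hh', k', hk', hp', he'⟩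
    have m1 := tensorFunctions_mono X Y (U := U) (V := V) (U' := U ∩ U') (V' := V ∩ V')
      Set.inter_subset_left Set.inter_subset_left
    have m2 := tensorFunctions_mono X Y (U := U') (V := V') (U' := U ∩ U') (V' := V ∩ V')
      Set.inter_subset_right Set.inter_subset_right
    refine ⟨U ∩ U', V ∩ V', hU.inter hU', hV.inter hV', ⟨h1, h1'⟩, ⟨h2, h2'⟩, h * h',
      mul_mem (m1 hh) (m2 hh'), k * k', mul_mem (m1 hk) (m2 hk'), mul_ne_zero hp hp', ?_⟩
    filter_upwards [he, he'] with q e e'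
    simp only [Pi.mul_apply, e, e']
    rw [div_mul_div_comm]
  eventually := by
    rintro f p ⟨U, V, hU, hV, h1, h2, h, hh, k, hk, hp, he⟩
    filter_upwards [prod_eventually X Y hU hV hk h1 h2 hp,
      @Filter.Eventually.eventually_nhds _ (prodTopology X Y) _ _ he] with q n e
    exact ⟨U, V, hU, hV, n.1, n.2.1, h, hh, k, hk, n.2.2, e⟩
  inv := by
    rintro f p ⟨U, V, hU, hV, h1, h2, h, hh, k, hk, hp, he⟩ hf
    have hhp : h p ≠ 0 := by
      intro h0
      apply hf
      rw [@Filter.Eventually.self_of_nhds _ (prodTopology X Y) _ _ he, h0, zero_div]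
    refine ⟨?_, U, V, hU, hV, h1, h2, k, hk, h, hh, hhp, ?_⟩
    · filter_upwards [prod_eventually X Y hU hV hk h1 h2 hp,
        prod_eventually X Y hU hV hh h1 h2 hhp, he] with q n n' e
      rw [e]
      exact div_ne_zero n'.2.2 n.2.2
    · filter_upwards [he] with q e
      rw [Pi.inv_apply, e, inv_div]

/-! ### Weighted projective spaces and quasi-projective varieties -/

/-- The orbit relation of the action `t · v = (t ^ (w i) * v i)ᵢ` of `ℂˣ` on `ℂ^ι` with integral
weights `w`. -/
def weightedSetoid {ι : Type} (w : ι → ℤ) : Setoid (ι → ℂ) where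
  r := fun u v => ∃ t : ℂˣ, ∀ i, v i = ((t ^ w i : ℂˣ) : ℂ) * u i
  iseqv :=
    { refl := fun u => ⟨1, fun i => by simp⟩
      symm := by
        rintro u v ⟨t, ht⟩
        refine ⟨t⁻¹, fun i => ?_⟩
        rw [ht i, ← mul_assoc, ← Units.val_mul, ← mul_zpow]
        simp
      trans := by
        rintro u v z ⟨t, ht⟩ ⟨s, hs⟩
        refine ⟨s * t, fun i => ?_⟩
        rw [hs i, ht i, ← mul_assoc, ← Units.val_mul, ← mul_zpow] }

/-- The weighted projective space `(ℂ^ι ∖ {0}) / ℂˣ` with integral weights `w`. -/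
def weightedProjectiveSpace {ι : Type} (w : ι → ℤ) : SpaceWithFunctions :=
  ((affineSpace (ι → ℂ)).restrict {v : ι → ℂ | v ≠ 0}).quotient
    ((weightedSetoid w).comap Subtype.val)

/-- The class of a nonzero vector in the weighted projective space. -/
def weightedProjectiveSpace.mk {ι : Type} (w : ι → ℤ) (v : ι → ℂ) (hv : v ≠ 0) :
    (weightedProjectiveSpace w).carrier :=
  Quotient.mk ((weightedSetoid w).comap (Subtype.val : {v : ι → ℂ | v ≠ 0} → ι → ℂ)) ⟨v, hv⟩

/-- The projective space `ℙ^N(ℂ)`. -/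
def projectiveSpace (N : ℕ) : SpaceWithFunctions :=
  weightedProjectiveSpace (fun _ : Fin (N + 1) => (1 : ℤ))

/-- An (irreducible) quasi-projective variety: irreducible, and isomorphic to a locally closed subset
of a projective space with the induced structure. -/
def IsQuasiProjectiveVariety (X : SpaceWithFunctions) : Prop :=
  IrreducibleSpace X.carrier ∧
    ∃ (N : ℕ) (S : Set (projectiveSpace N).carrier), IsLocallyClosed S ∧
      Nonempty (Iso X ((projectiveSpace N).restrict S))

end SpaceWithFunctions

/-! ### ADHM data -/

namespace ADHM

open SpaceWithFunctions

/-- `End(V) ⊕ End(V) ⊕ Hom(W,V) ⊕ Hom(V,W)` for `V = ℂ^c` and `W = ℂ^r`. -/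
abbrev Quadruple (r c : ℕ) : Type :=
  Matrix (Fin c) (Fin c) ℂ × Matrix (Fin c) (Fin c) ℂ ×
    Matrix (Fin c) (Fin r) ℂ × Matrix (Fin r) (Fin c) ℂ

/-- ADHM data over `ℙ^(d+2)`: the tuple `(A_k, B_k, I_k, J_k)` for `k = 0, …, d` stands for
`A = ∑ A_k z_k`, `B = ∑ B_k z_k`, `I = ∑ I_k z_k`, `J = ∑ J_k z_k`. -/
abbrev Datum (d r c : ℕ) : Type := Fin (d + 1) → Quadruple r c

variable {d r c : ℕ}

def Datum.A (X : Datum d r c) (k : Fin (d + 1)) : Matrix (Fin c) (Fin c) ℂ := (X k).1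
def Datum.B (X : Datum d r c) (k : Fin (d + 1)) : Matrix (Fin c) (Fin c) ℂ := (X k).2.1
def Datum.I (X : Datum d r c) (k : Fin (d + 1)) : Matrix (Fin c) (Fin r) ℂ := (X k).2.2.1
def Datum.J (X : Datum d r c) (k : Fin (d + 1)) : Matrix (Fin r) (Fin c) ℂ := (X k).2.2.2

/-- The matrix of linear forms `∑ M_k z_k`. -/
def linearForm {m n : Type} (M : Fin (d + 1) → Matrix m n ℂ) :
    Matrix m n (MvPolynomial (Fin (d + 1)) ℂ) :=
  ∑ k, (MvPolynomial.X k : MvPolynomial (Fin (d + 1)) ℂ) • (M k).map MvPolynomial.C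

/-- The ADHM equation `[A, B] + I J = 0`, an identity between matrices of quadratic forms in
`z_0, …, z_d`. -/
def Datum.IsSolution (X : Datum d r c) : Prop :=
  linearForm X.A * linearForm X.B - linearForm X.B * linearForm X.A +
    linearForm X.I * linearForm X.J = 0

/-- Stability of `(A, B, I, J)`: no proper subspace of `V` is invariant under `A` and `B` and
contains the image of `I`. -/
def Quadruple.IsStable (Y : Quadruple r c) : Prop :=
  ∀ S : Submodule ℂ (Fin c → ℂ), (∀ v ∈ S, Y.1.mulVec v ∈ S) → (∀ v ∈ S, Y.2.1.mulVec v ∈ S) →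
    (∀ u : Fin r → ℂ, Y.2.2.1.mulVec u ∈ S) → S = ⊤

/-- Global stability: the value of the datum at every point `P = (p_0 : … : p_d : x : y)` off the line
`z_0 = … = z_d = 0` is stable. This value involves only `p_0, …, p_d`. -/
def Datum.IsGloballyStable (X : Datum d r c) : Prop :=
  ∀ p : Fin (d + 1) → ℂ, p ≠ 0 → Quadruple.IsStable (∑ k, p k • X k)

/-- The action of `GL(V)`: `g · (A, B, I, J) = (g A g⁻¹, g B g⁻¹, g I, J g⁻¹)`. -/
def gaugeAction (g : GL (Fin c) ℂ) (X : Datum d r c) : Datum d r c := fun k =>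
  (g.val * X.A k * g⁻¹.val, g.val * X.B k * g⁻¹.val, g.val * X.I k, X.J k * g⁻¹.val)

lemma gaugeAction_one (X : Datum d r c) : gaugeAction 1 X = X := by
  funext k
  simp [gaugeAction, Datum.A, Datum.B, Datum.I, Datum.J]

lemma gaugeAction_mul (g h : GL (Fin c) ℂ) (X : Datum d r c) :
    gaugeAction g (gaugeAction h X) = gaugeAction (g * h) X := by
  funext k
  simp only [gaugeAction, Datum.A, Datum.B, Datum.I, Datum.J, mul_inv_rev, Units.val_mul,
    Matrix.mul_assoc]

/-- The orbit relation of the action of `GL(V)` on ADHM data. -/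
def gaugeSetoid (d r c : ℕ) : Setoid (Datum d r c) where
  r := fun X X' => ∃ g : GL (Fin c) ℂ, X' = gaugeAction g X
  iseqv :=
    { refl := fun X => ⟨1, (gaugeAction_one X).symm⟩
      symm := by
        rintro X _ ⟨g, rfl⟩
        exact ⟨g⁻¹, by rw [gaugeAction_mul, inv_mul_cancel, gaugeAction_one]⟩
      trans := by
        rintro X _ _ ⟨g, rfl⟩ ⟨h, rfl⟩
        exact ⟨h * g, by rw [gaugeAction_mul]⟩ }

/-- The globally stable solutions of the ADHM equation. -/
def globallyStableSolutions (d r c : ℕ) : Set (Datum d r c) :=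
  {X | X.IsSolution ∧ X.IsGloballyStable}

/-- The moduli space of globally stable solutions of the ADHM equation modulo `GL(V)`, with its
structure of quotient. -/
def moduliGS (d r c : ℕ) : SpaceWithFunctions :=
  ((affineSpace (Datum d r c)).restrict (globallyStableSolutions d r c)).quotient
    ((gaugeSetoid d r c).comap Subtype.val)

/-- The orbit of a globally stable solution. -/
def moduliGS.mk (X : Datum d r c) (hX : X ∈ globallyStableSolutions d r c) :
    (moduliGS d r c).carrier :=
  Quotient.mk ((gaugeSetoid d r c).comap
    (Subtype.val : globallyStableSolutions d r c → Datum d r c)) ⟨X, hX⟩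

/-! ### The case of charge one -/

/-- The index set of the coordinates of `(I, J)` for `c = 1`: the coordinates of the row vectors `I_k`
and of the column vectors `J_k`. -/
abbrev PairIndex (d r : ℕ) : Type := (Fin (d + 1) × Fin r) ⊕ (Fin (d + 1) × Fin r)

/-- The weights: `1` on the coordinates of `I` and `-1` on those of `J`. -/
def pairWeights (d r : ℕ) : PairIndex d r → ℤ := Sum.elim (fun _ => 1) (fun _ => -1)

/-- The weighted projective space `ℙ(1, …, 1, -1, …, -1)`. -/
def pairSpace (d r : ℕ) : SpaceWithFunctions := weightedProjectiveSpace (pairWeights d r)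

/-- The vector `I_k`. -/
def pairI (v : PairIndex d r → ℂ) (k : Fin (d + 1)) : Fin r → ℂ := fun i => v (Sum.inl (k, i))

/-- The vector `J_k`. -/
def pairJ (v : PairIndex d r → ℂ) (k : Fin (d + 1)) : Fin r → ℂ := fun i => v (Sum.inr (k, i))

/-- The equations `I_k J_k = 0` for all `k`, and `I_k J_m + I_m J_k = 0` for `k < m`. -/
def PairEquations (v : PairIndex d r → ℂ) : Prop :=
  (∀ k, dotProduct (pairI v k) (pairJ v k) = 0) ∧
    ∀ k m, k < m → dotProduct (pairI v k) (pairJ v m) + dotProduct (pairI v m) (pairJ v k) = 0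

/-- The set of solutions in the weighted projective space. -/
def pairSolutions (d r : ℕ) : Set (pairSpace d r).carrier :=
  {q | ∃ (v : PairIndex d r → ℂ) (hv : v ≠ 0),
    weightedProjectiveSpace.mk (pairWeights d r) v hv = q ∧ PairEquations v}

/-- The set of solutions in the weighted projective space for which the `I_k` are linearly
independent. -/
def independentPairSolutions (d r : ℕ) : Set (pairSpace d r).carrier :=
  {q | ∃ (v : PairIndex d r → ℂ) (hv : v ≠ 0),
    weightedProjectiveSpace.mk (pairWeights d r) v hv = q ∧ PairEquations v ∧
      LinearIndependent ℂ (pairI v)}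

/-- The product of `ℂ^(2(d+1))` and the variety of solutions with linearly independent `I_k`. -/
def chargeOneModel (d r : ℕ) : SpaceWithFunctions :=
  (affineSpace (Fin (d + 1) ⊕ Fin (d + 1) → ℂ)).prod
    ((pairSpace d r).restrict (independentPairSolutions d r))

/-- For `c = 1`, the numbers `(A_0, …, A_d, B_0, …, B_d)`. -/
def abCoords (X : Datum d r 1) : Fin (d + 1) ⊕ Fin (d + 1) → ℂ :=
  Sum.elim (fun k => X.A k 0 0) (fun k => X.B k 0 0)

/-- For `c = 1`, the coordinates of `(I, J)`. -/
def ijCoords (X : Datum d r 1) : PairIndex d r → ℂ :=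
  Sum.elim (fun a => X.I a.1 0 a.2) (fun a => X.J a.1 a.2 0)

end ADHM

end

/-! For $c=1$ the matrices $A_k,B_k$ are numbers, so the commutator vanishes and the ADHM equation
says that the quadratic form $\sum z_kz_m I_kJ_m$ is zero, that is, the $(d+1)\times(d+1)$ matrix
$IJ$ has zero symmetric part (`isSolution_iff`). The only proper subspace of $V=\mathbb C$ is $0$,
so stability at $P$ means $I_P\ne0$, and global stability means that $I_0,\dots,I_d\in\mathbb C^r$
are linearly independent (`isGloballyStable_iff`); this forces $r>d$. The group $GL(1)=\mathbb C^*$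
fixes $A,B$ and scales $I,J$ with weights $1,-1$ (`gaugeSetoid_iff`). Hence
$[A,B,I,J]\mapsto((A,B),[I,J])$ is bijective. It is a morphism by the universal properties of
quotient, subspace and product. Its inverse is one because the quotient by $\mathbb C^*$ has regular
local sections, obtained by normalizing a nonzero coordinate to $1$ (`isMorphismAt_chartSection`).

The geometry rests on one linear-algebra fact. For $I$ of full rank with right inverse $N$, the map
$J\mapsto$ symmetric part of $IJ$ is onto, so its kernel $K_I$ has dimension $(d+1)r-\binom{d+2}2$
(`finrank_ker_symPart`). Moreover $K_{IG}=G^{-1}K_I$ for $G\in GL_r$, because $(IG)(G^{-1}K)=IK$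
(`pairOf_mul_inv_mul_mem`). Two consequences follow.

Irreducibility: $GL_r$ acts transitively on matrices $I$ of full rank, so the moduli space is the
image of an open subset of the affine space $\mathbb C^{2(d+1)}\times M_r\times K_I$ for one fixed
$I$.

Smoothness and dimension: near $I$ the choice $G=1+N(I'-I)$ satisfies $IG=I'$ and is regular in
$I'$, so it trivializes the family of kernels. With one coordinate of $I'$ normalized to $1$, this
gives charts onto open subsets of affine space (`isLocallyAffine_chart`), of dimension
$2(d+1)+\big((d+1)r-1\big)+\big((d+1)r-\binom{d+2}2\big)$. Regularity of local rings and Krull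
dimension are then read off from affine space.

Quasi-projectivity: the functions $I_a$, $I_au_k$, $I_aI_bJ_c$, with $u=(A,B)$, all have weight $1$
and serve as homogeneous coordinates. Their image is cut out by closed equations and the open
condition that the $I_k$ are independent, and on $I_a\ne0$ the point is recovered regularly
(`isLocallyClosed_range_segreEmbedding`, `moduliGSSegreIso`). -/

namespace SpaceWithFunctions

/-- `f` is a morphism of spaces with functions near `x`: it is continuous at `x` and pulls functions
regular at `f x` back to functions regular at `x`. -/
def IsMorphismAt (X Y : SpaceWithFunctions) (f : X.carrier → Y.carrier) (x : X.carrier) : Prop :=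
  ContinuousAt f x ∧ ∀ g : Y.carrier → ℂ, Y.IsRegularAt g (f x) → X.IsRegularAt (fun z => g (f z)) x

/-! ### Morphisms and the algebra of regular functions -/

variable {X Y Z : SpaceWithFunctions}

theorem continuousAt_of_forall_isOpen {A B : Type*} [TopologicalSpace A] [TopologicalSpace B]
    {f : A → B} {x : A} (h : ∀ O, IsOpen O → f x ∈ O → ∀ᶠ y in 𝓝 x, f y ∈ O) : ContinuousAt f x :=
  tendsto_nhds.2 h

theorem continuousAt_generateFrom {A B : Type*} [TopologicalSpace A] {S : Set (Set B)}
    {f : A → B} {x : A} (h : ∀ O ∈ S, f x ∈ O → ∀ᶠ y in 𝓝 x, f y ∈ O) :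
    @ContinuousAt A B _ (TopologicalSpace.generateFrom S) f x :=
  TopologicalSpace.tendsto_nhds_generateFrom_iff.2 h

theorem IsMorphismAt.comp {g : Y.carrier → Z.carrier} {f : X.carrier → Y.carrier} {x : X.carrier}
    (hg : IsMorphismAt Y Z g (f x)) (hf : IsMorphismAt X Y f x) :
    IsMorphismAt X Z (fun z => g (f z)) x :=
  ⟨ContinuousAt.comp (f := f) hg.1 hf.1, fun k hk => hf.2 _ (hg.2 k hk)⟩

theorem IsMorphismAt.congr {f g : X.carrier → Y.carrier} {x : X.carrier}
    (hf : IsMorphismAt X Y f x) (h : f =ᶠ[𝓝 x] g) : IsMorphismAt X Y g x := by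
  refine ⟨hf.1.congr h, fun k hk => ?_⟩
  rw [← h.eq_of_nhds] at hk
  exact X.congr_germ (h.fun_comp k) (hf.2 k hk)

/-- The algebra of functions that are regular at a point. -/
def regularAt (X : SpaceWithFunctions) (x : X.carrier) : Subalgebra ℂ (X.carrier → ℂ) where
  carrier := {f | X.IsRegularAt f x}
  mul_mem' := X.mul
  add_mem' := X.add
  algebraMap_mem' := fun a => X.const a x

theorem mem_regularAt {x : X.carrier} {f : X.carrier → ℂ} :
    f ∈ X.regularAt x ↔ X.IsRegularAt f x := Iff.rfl

theorem IsRegularAt.sub {f g : X.carrier → ℂ} {x : X.carrier} (hf : X.IsRegularAt f x)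
    (hg : X.IsRegularAt g x) : X.IsRegularAt (fun y => f y - g y) x :=
  (X.regularAt x).sub_mem hf hg

theorem IsRegularAt.sum {ι : Type*} {s : Finset ι} {f : ι → X.carrier → ℂ} {x : X.carrier}
    (hf : ∀ i ∈ s, X.IsRegularAt (f i) x) : X.IsRegularAt (fun y => ∑ i ∈ s, f i y) x := by
  have := sum_mem (S := X.regularAt x) hf
  rwa [mem_regularAt, Finset.sum_fn] at this

theorem IsRegularAt.prod {ι : Type*} {s : Finset ι} {f : ι → X.carrier → ℂ} {x : X.carrier}
    (hf : ∀ i ∈ s, X.IsRegularAt (f i) x) : X.IsRegularAt (fun y => ∏ i ∈ s, f i y) x := by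
  have := prod_mem (S := X.regularAt x) hf
  rwa [mem_regularAt, Finset.prod_fn] at this

theorem IsRegularAt.div {f g : X.carrier → ℂ} {x : X.carrier} (hf : X.IsRegularAt f x)
    (hg : X.IsRegularAt g x) (h : g x ≠ 0) : X.IsRegularAt (fun y => f y / g y) x := by
  have := X.mul hf (X.inv hg h).2
  rwa [← div_eq_mul_inv] at this

theorem IsRegularAt.eventually_ne {f : X.carrier → ℂ} {x : X.carrier} (hf : X.IsRegularAt f x)
    (h : f x ≠ 0) : ∀ᶠ y in 𝓝 x, f y ≠ 0 := (X.inv hf h).1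

theorem IsRegularAt.det {n : Type*} [Fintype n] [DecidableEq n] {M : X.carrier → Matrix n n ℂ}
    {x : X.carrier} (hM : ∀ i j, X.IsRegularAt (fun y => M y i j) x) :
    X.IsRegularAt (fun y => (M y).det) x := by
  simp only [Matrix.det_apply']
  exact .sum fun σ _ => X.mul (X.const _ x) (.prod fun i _ => hM _ _)

theorem IsRegularAt.matrix_mul {l m n : Type*} [Fintype m] {M : X.carrier → Matrix l m ℂ}
    {N : X.carrier → Matrix m n ℂ} {x : X.carrier}
    (hM : ∀ i j, X.IsRegularAt (fun y => M y i j) x)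
    (hN : ∀ i j, X.IsRegularAt (fun y => N y i j) x) (i : l) (j : n) :
    X.IsRegularAt (fun y => (M y * N y) i j) x := by
  simp only [Matrix.mul_apply]
  exact .sum fun k _ => X.mul (hM _ _) (hN _ _)

/-- Cramer's rule: the entries of the adjugate are again determinants. -/
theorem IsRegularAt.matrix_inv {n : Type*} [Fintype n] [DecidableEq n]
    {M : X.carrier → Matrix n n ℂ} {x : X.carrier}
    (hM : ∀ i j, X.IsRegularAt (fun y => M y i j) x) (h : (M x).det ≠ 0) (i j : n) :
    X.IsRegularAt (fun y => (M y)⁻¹ i j) x := by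
  simp only [Matrix.inv_def, Matrix.smul_apply, Ring.inverse_eq_inv', smul_eq_mul]
  refine X.mul (X.inv (IsRegularAt.det hM) h).2 ?_
  simp only [Matrix.adjugate_apply]
  refine IsRegularAt.det fun k l => ?_
  simp only [Matrix.updateRow_apply]
  split_ifs
  · exact X.const _ x
  · exact hM _ _

/-! ### Subspaces -/

theorem isMorphismAt_subtype_val (S : Set X.carrier) (x : (X.restrict S).carrier) :
    IsMorphismAt (X.restrict S) X Subtype.val x :=
  ⟨continuous_subtype_val.continuousAt, fun g hg => ⟨g, hg, EventuallyEq.rfl⟩⟩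

theorem IsMorphismAt.codRestrict {S : Set X.carrier} {f : Z.carrier → (X.restrict S).carrier}
    {z : Z.carrier} (hf : IsMorphismAt Z X (fun y => (f y).1) z) :
    IsMorphismAt Z (X.restrict S) f z := by
  have hc : ContinuousAt f z := IsInducing.subtypeVal.continuousAt_iff.2 hf.1
  refine ⟨hc, ?_⟩
  rintro g ⟨G, hG, h⟩
  exact Z.congr_germ (hc.eventually h.symm) (hf.2 G hG)

/-! ### Quotients -/

theorem isMorphismAt_quotient_mk (s : Setoid X.carrier) (x : X.carrier) :
    IsMorphismAt X (X.quotient s) (Quotient.mk s) x :=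
  ⟨continuous_quotient_mk'.continuousAt, fun _ hg => hg.self_of_nhds x rfl⟩

theorem isOpen_quotient_iff {s : Setoid X.carrier} {U : Set (X.quotient s).carrier} :
    IsOpen U ↔ IsOpen (X := X.carrier) {x | (Quotient.mk s x : (X.quotient s).carrier) ∈ U} :=
  (isQuotientMap_quotient_mk' (s := s)).isOpen_preimage.symm

/-- Universal property of the quotient. The hypothesis concerns a whole open set $U$, because
regularity at a point of the quotient involves every representative of every nearby class. -/
theorem isMorphismAt_of_quotient {s : Setoid X.carrier} {f : (X.quotient s).carrier → Y.carrier}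
    {U : Set (X.quotient s).carrier} (hU : IsOpen U)
    (hf : ∀ x : X.carrier, Quotient.mk s x ∈ U →
      IsMorphismAt X Y (fun y => f (Quotient.mk s y)) x)
    {q : (X.quotient s).carrier} (hq : q ∈ U) : IsMorphismAt (X.quotient s) Y f q := by
  have hc : ∀ q ∈ U, ContinuousAt f q := by
    intro q hq
    refine continuousAt_of_forall_isOpen fun O hO hqO => ?_
    have ho : IsOpen (U ∩ f ⁻¹' O) := by
      rw [isOpen_quotient_iff, isOpen_iff_mem_nhds]
      rintro x ⟨hx, hx'⟩
      exact inter_mem (continuous_quotient_mk'.continuousAt.preimage_mem_nhds (hU.mem_nhds hx))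
        ((hf x hx).1.preimage_mem_nhds (hO.mem_nhds hx'))
    exact mem_of_superset (ho.mem_nhds ⟨hq, hqO⟩) Set.inter_subset_right
  refine ⟨hc q hq, fun g hg => ?_⟩
  change ∀ᶠ q' in 𝓝 q, _
  filter_upwards [(hc q hq).eventually (Y.eventually hg), hU.mem_nhds hq] with q' h1 h2 x hx
  subst hx
  exact (hf x h2).2 g h1

/-- The map is locally a lift followed by the projection. Only local lifts exist over a nontrivial
quotient, so the lift has to land in $T$ only near $z$. -/
theorem isMorphismAt_quotient_restrict_of_lift {T : Set X.carrier}
    {s : Setoid (X.restrict T).carrier} {g : Z.carrier → ((X.restrict T).quotient s).carrier}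
    {F : Z.carrier → X.carrier} {z : Z.carrier} (hF : IsMorphismAt Z X F z)
    (h : ∀ᶠ y in 𝓝 z, ∃ hy : F y ∈ T, g y = Quotient.mk s ⟨F y, hy⟩) :
    IsMorphismAt Z ((X.restrict T).quotient s) g z := by
  classical
  obtain ⟨hz, -⟩ := h.self_of_nhds
  -- Away from $z$ the value is irrelevant; the constant $F(z)$ makes the lift a total map into $T$.
  let F' : Z.carrier → (X.restrict T).carrier := fun y =>
    if hy : F y ∈ T then ⟨F y, hy⟩ else ⟨F z, hz⟩
  have hF' : IsMorphismAt Z (X.restrict T) F' z := by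
    refine IsMorphismAt.codRestrict (hF.congr ?_)
    filter_upwards [h] with y hy
    simp [F', hy.1]
  refine ((isMorphismAt_quotient_mk s (F' z)).comp hF').congr ?_
  filter_upwards [h] with y hy
  obtain ⟨hy, hgy⟩ := hy
  rw [hgy]
  exact congrArg (Quotient.mk s) (dif_pos hy)

/-! ### Products -/

/-- The constant $1$ is a tensor function, so open boxes are basic open sets of the product. -/
theorem isMorphismAt_fst (p : (X.prod Y).carrier) :
    IsMorphismAt (X.prod Y) X Prod.fst p := by
  constructor
  · refine continuousAt_of_forall_isOpen fun O hO hp => ?_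
    filter_upwards [prod_eventually X Y hO isOpen_univ (one_mem (tensorFunctions X Y O Set.univ))
      hp trivial one_ne_zero] with q hq using hq.1
  · intro g hg
    obtain ⟨U, hU, hUo, hpU⟩ := eventually_nhds_iff.1 (X.eventually hg)
    exact ⟨U, Set.univ, hUo, isOpen_univ, hpU, trivial, _,
      Algebra.subset_adjoin (Or.inl ⟨g, hU, rfl⟩), 1, one_mem _, one_ne_zero,
      Eventually.of_forall fun q => by simp⟩

theorem isMorphismAt_snd (p : (X.prod Y).carrier) :
    IsMorphismAt (X.prod Y) Y Prod.snd p := by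
  constructor
  · refine continuousAt_of_forall_isOpen fun O hO hp => ?_
    filter_upwards [prod_eventually X Y isOpen_univ hO (one_mem (tensorFunctions X Y Set.univ O))
      trivial hp one_ne_zero] with q hq using hq.2.1
  · intro g hg
    obtain ⟨U, hU, hUo, hpU⟩ := eventually_nhds_iff.1 (Y.eventually hg)
    exact ⟨Set.univ, U, isOpen_univ, hUo, trivial, hpU, _,
      Algebra.subset_adjoin (Or.inr ⟨g, hU, rfl⟩), 1, one_mem _, one_ne_zero,
      Eventually.of_forall fun q => by simp⟩

theorem isRegularAt_tensorFunctions_comp {U : Set X.carrier} {V : Set Y.carrier}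
    {f : Z.carrier → X.carrier} {g : Z.carrier → Y.carrier} {z : Z.carrier}
    (hf : IsMorphismAt Z X f z) (hg : IsMorphismAt Z Y g z) (hU : f z ∈ U) (hV : g z ∈ V)
    {h : X.carrier × Y.carrier → ℂ} (hh : h ∈ tensorFunctions X Y U V) :
    Z.IsRegularAt (fun y => h (f y, g y)) z := by
  induction hh using Algebra.adjoin_induction with
  | mem h hh =>
    obtain ⟨k, hk, rfl⟩ | ⟨k, hk, rfl⟩ := hh
    · exact hf.2 k (hk _ hU)
    · exact hg.2 k (hk _ hV)
  | algebraMap a => exact Z.const a z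
  | add _ _ _ _ h1 h2 => exact Z.add h1 h2
  | mul _ _ _ _ h1 h2 => exact Z.mul h1 h2

/-- Although the topology is finer than the product topology, the universal property holds: tensor
functions pull back to regular functions, whose nonvanishing is an open condition. -/
theorem IsMorphismAt.prodMk {f : Z.carrier → X.carrier} {g : Z.carrier → Y.carrier} {z : Z.carrier}
    (hf : IsMorphismAt Z X f z) (hg : IsMorphismAt Z Y g z) :
    IsMorphismAt Z (X.prod Y) (fun y => (f y, g y)) z := by
  have hc : @ContinuousAt _ _ _ (prodTopology X Y) (fun y => (f y, g y)) z := by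
    refine continuousAt_generateFrom ?_
    rintro _ ⟨U, V, hU, hV, h, hh, rfl⟩ ⟨h1, h2, h3⟩
    have hr := isRegularAt_tensorFunctions_comp hf hg h1 h2 hh
    filter_upwards [hf.1.preimage_mem_nhds (hU.mem_nhds h1),
      hg.1.preimage_mem_nhds (hV.mem_nhds h2), IsRegularAt.eventually_ne hr h3] with y a b c
    exact ⟨a, b, c⟩
  refine ⟨hc, ?_⟩
  rintro k ⟨U, V, hU, hV, h1, h2, h, hh, h', hh', hne, he⟩
  refine Z.congr_germ ?_ (IsRegularAt.div (isRegularAt_tensorFunctions_comp hf hg h1 h2 hh)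
    (isRegularAt_tensorFunctions_comp hf hg h1 h2 hh') hne)
  have := @Filter.Tendsto.eventually _ _ _ _ _ _ hc he
  filter_upwards [this] with y hy using hy.symm

/-! ### Isomorphisms -/

/-- Mutually inverse morphisms form an isomorphism. -/
def Iso.ofInverse (f : X.carrier → Y.carrier) (g : Y.carrier → X.carrier)
    (hgf : ∀ x, g (f x) = x) (hfg : ∀ y, f (g y) = y)
    (hf : ∀ x, IsMorphismAt X Y f x) (hg : ∀ y, IsMorphismAt Y X g y) : Iso X Y where
  toHomeomorph :=
    { toFun := f
      invFun := g
      left_inv := hgf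
      right_inv := hfg
      continuous_toFun := continuous_iff_continuousAt.2 fun x => (hf x).1
      continuous_invFun := continuous_iff_continuousAt.2 fun y => (hg y).1 }
  regular_iff := by
    intro k x
    refine ⟨fun h => ?_, fun h => (hf x).2 k h⟩
    have h' : X.IsRegularAt (fun z => k (f z)) (g (f x)) := by rw [hgf]; exact h
    have := (hg (f x)).2 _ h'
    simp only [hfg] at this
    exact this

/-! ### Affine space -/

section Affine

variable {V : Type} [AddCommGroup V] [Module ℂ V]

theorem linear_mem_polynomialFunctions (l : V →ₗ[ℂ] ℂ) : (fun v => l v) ∈ polynomialFunctions V :=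
  Algebra.subset_adjoin ⟨l, rfl⟩

theorem isRegularAt_polynomial {p : V → ℂ} (hp : p ∈ polynomialFunctions V) (v : V) :
    (affineSpace V).IsRegularAt p v :=
  ⟨p, hp, 1, one_mem _, one_ne_zero, Eventually.of_forall fun y => by simp⟩

theorem isRegularAt_linear (l : V →ₗ[ℂ] ℂ) (v : V) :
    (affineSpace V).IsRegularAt (fun y => l y) v :=
  isRegularAt_polynomial (linear_mem_polynomialFunctions l) v

theorem isRegularAt_polynomial_comp {f : Z.carrier → V} {z : Z.carrier}
    (hf : ∀ l : V →ₗ[ℂ] ℂ, Z.IsRegularAt (fun y => l (f y)) z) {p : V → ℂ}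
    (hp : p ∈ polynomialFunctions V) : Z.IsRegularAt (fun y => p (f y)) z := by
  induction hp using Algebra.adjoin_induction with
  | mem h hh =>
    obtain ⟨l, rfl⟩ := hh
    exact hf l
  | algebraMap a => exact Z.const a z
  | add _ _ _ _ h1 h2 => exact Z.add h1 h2
  | mul _ _ _ _ h1 h2 => exact Z.mul h1 h2

/-- Linear forms generate the polynomial functions, which in turn determine both the Zariski
topology and the regular functions. -/
theorem isMorphismAt_affineSpace {f : Z.carrier → (affineSpace V).carrier} {z : Z.carrier}
    (hf : ∀ l : V →ₗ[ℂ] ℂ, Z.IsRegularAt (fun y => l (f y)) z) :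
    IsMorphismAt Z (affineSpace V) f z := by
  have hc : @ContinuousAt _ V _ (zariskiTopology V) f z := by
    refine continuousAt_generateFrom ?_
    rintro _ ⟨p, hp, rfl⟩ h
    exact IsRegularAt.eventually_ne (isRegularAt_polynomial_comp hf hp) h
  refine ⟨hc, ?_⟩
  rintro k ⟨p, hp, q, hq, hne, he⟩
  refine Z.congr_germ ?_ (IsRegularAt.div (isRegularAt_polynomial_comp hf hp)
    (isRegularAt_polynomial_comp hf hq) hne)
  have := @Filter.Tendsto.eventually _ _ _ _ _ _ hc he
  filter_upwards [this] with y hy using hy.symm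

theorem isMorphismAt_affineSpace_basis {ι : Type*} [Finite ι] (b : Module.Basis ι ℂ V)
    {f : Z.carrier → (affineSpace V).carrier} {z : Z.carrier}
    (hf : ∀ i, Z.IsRegularAt (fun y => b.coord i (f y)) z) :
    IsMorphismAt Z (affineSpace V) f z := by
  have := Fintype.ofFinite ι
  refine isMorphismAt_affineSpace fun l => ?_
  have : (fun y => l (f y)) = fun y => ∑ i, l (b i) * b.coord i (f y) := by
    funext y
    conv_lhs => rw [← b.sum_repr (f y)]
    simp only [map_sum, map_smul, smul_eq_mul]
    exact Finset.sum_congr rfl fun i _ => mul_comm _ _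
  rw [this]
  exact .sum fun i _ => Z.mul (Z.const _ z) (hf i)

theorem isMorphismAt_pi {ι : Type} [Finite ι] {f : Z.carrier → (affineSpace (ι → ℂ)).carrier}
    {z : Z.carrier} (hf : ∀ i, Z.IsRegularAt (fun y => f y i) z) :
    IsMorphismAt Z (affineSpace (ι → ℂ)) f z :=
  isMorphismAt_affineSpace_basis (Pi.basisFun ℂ ι) fun i => hf i

end Affine

end SpaceWithFunctions

namespace SpaceWithFunctions

variable {X Y : SpaceWithFunctions}

/-! ### Local rings -/

/-- The pull-back of germs of regular functions. -/
def localRingMap {f : X.carrier → Y.carrier} {x : X.carrier} (hf : IsMorphismAt X Y f x) :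
    Y.localRing (f x) →+* X.localRing x where
  toFun g := ⟨g.1.compTendsto f hf.1, by
    obtain ⟨_, k, hk, rfl⟩ := g
    exact ⟨_, hf.2 k hk, rfl⟩⟩
  map_one' := rfl
  map_zero' := rfl
  map_add' := by
    rintro ⟨_, k, hk, rfl⟩ ⟨_, l, hl, rfl⟩
    rfl
  map_mul' := by
    rintro ⟨_, k, hk, rfl⟩ ⟨_, l, hl, rfl⟩
    rfl

/-- The equality of neighbourhood filters gives injectivity on germs, and `hs` gives surjectivity.
Open inclusions and isomorphisms satisfy both conditions. -/
theorem localRingMap_bijective {f : X.carrier → Y.carrier} {x : X.carrier}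
    (hf : IsMorphismAt X Y f x) (hm : map f (𝓝 x) = 𝓝 (f x))
    (hs : ∀ h, X.IsRegularAt h x → ∃ k, Y.IsRegularAt k (f x) ∧ h =ᶠ[𝓝 x] fun z => k (f z)) :
    Function.Bijective (localRingMap hf) := by
  constructor
  · rintro ⟨_, k, hk, rfl⟩ ⟨_, l, hl, rfl⟩ h
    have h' := Germ.coe_eq.1 (congrArg Subtype.val h)
    refine Subtype.ext (Germ.coe_eq.2 ?_)
    rw [← hm]
    exact h'
  · rintro ⟨_, k, hk, rfl⟩
    obtain ⟨l, hl, h⟩ := hs k hk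
    exact ⟨⟨_, l, hl, rfl⟩, Subtype.ext (Germ.coe_eq.2 h.symm)⟩

theorem isRegularLocalRing_restrict_iff {U : Set X.carrier} (hU : IsOpen U)
    (x : (X.restrict U).carrier) :
    IsRegularLocalRing ((X.restrict U).localRing x) ↔ IsRegularLocalRing (X.localRing x.1) := by
  let e := RingEquiv.ofBijective _ (localRingMap_bijective (isMorphismAt_subtype_val U x)
    (hU.isOpenEmbedding_subtypeVal.map_nhds_eq x) fun _ hh => hh)
  exact ⟨fun _ => .of_ringEquiv e.symm, fun _ => .of_ringEquiv e⟩

theorem Iso.isMorphismAt (Φ : Iso X Y) (x : X.carrier) :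
    IsMorphismAt X Y Φ.toHomeomorph x :=
  ⟨Φ.toHomeomorph.continuous.continuousAt, fun g hg => (Φ.regular_iff g x).2 hg⟩

theorem Iso.isRegularLocalRing_iff (Φ : Iso X Y) (x : X.carrier) :
    IsRegularLocalRing (X.localRing x) ↔ IsRegularLocalRing (Y.localRing (Φ.toHomeomorph x)) := by
  let e := RingEquiv.ofBijective _ (localRingMap_bijective (Φ.isMorphismAt x)
    (Φ.toHomeomorph.isOpenEmbedding.map_nhds_eq x) fun h hh => by
      refine ⟨fun y => h (Φ.toHomeomorph.symm y), ?_, Eventually.of_forall fun z => by simp⟩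
      rw [← Φ.regular_iff]
      simpa using hh)
  exact ⟨fun _ => .of_ringEquiv e.symm, fun _ => .of_ringEquiv e⟩

/-! ### Polynomial functions and polynomials -/

section Affine

variable {V : Type} [AddCommGroup V] [Module ℂ V] {ι : Type*}

/-- The polynomial function given by a polynomial in the coordinates of a basis. -/
noncomputable def polyEval (b : Module.Basis ι ℂ V) : MvPolynomial ι ℂ →ₐ[ℂ] (V → ℂ) :=
  MvPolynomial.aeval fun i v => b.coord i v

theorem polyEval_apply (b : Module.Basis ι ℂ V) (p : MvPolynomial ι ℂ) (v : V) :
    polyEval b p v = MvPolynomial.eval (fun i => b.coord i v) p := by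
  induction p using MvPolynomial.induction_on with
  | C a => simp [polyEval]
  | add p q hp hq => simp [hp, hq]
  | mul_X p i hp =>
    rw [map_mul, Pi.mul_apply, hp, polyEval, MvPolynomial.aeval_X]
    simp

theorem polyEval_mem (b : Module.Basis ι ℂ V) (p : MvPolynomial ι ℂ) :
    polyEval b p ∈ polynomialFunctions V := by
  induction p using MvPolynomial.induction_on with
  | C a =>
    rw [← MvPolynomial.algebraMap_eq, AlgHom.commutes]
    exact (polynomialFunctions V).algebraMap_mem a
  | add p q hp hq =>
    rw [map_add]
    exact add_mem hp hq
  | mul_X p i hp =>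
    rw [map_mul, polyEval, MvPolynomial.aeval_X]
    exact mul_mem hp (linear_mem_polynomialFunctions (b.coord i))

theorem exists_polyEval_eq [Finite ι] (b : Module.Basis ι ℂ V) {f : V → ℂ}
    (hf : f ∈ polynomialFunctions V) : ∃ p, polyEval b p = f := by
  have := Fintype.ofFinite ι
  induction hf using Algebra.adjoin_induction with
  | mem f hf =>
    obtain ⟨l, rfl⟩ := hf
    refine ⟨∑ i, MvPolynomial.C (l (b i)) * MvPolynomial.X i, ?_⟩
    funext v
    conv_rhs => rw [← b.sum_repr v, map_sum]
    rw [polyEval_apply]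
    simp only [map_sum, map_mul, MvPolynomial.eval_C, MvPolynomial.eval_X, map_smul, smul_eq_mul,
      Module.Basis.coord_apply, mul_comm]
  | algebraMap a => exact ⟨algebraMap _ _ a, AlgHom.commutes _ _⟩
  | add _ _ _ _ h1 h2 =>
    obtain ⟨p, rfl⟩ := h1
    obtain ⟨q, rfl⟩ := h2
    exact ⟨p + q, map_add _ _ _⟩
  | mul _ _ _ _ h1 h2 =>
    obtain ⟨p, rfl⟩ := h1
    obtain ⟨q, rfl⟩ := h2
    exact ⟨p * q, map_mul _ _ _⟩

theorem polyEval_injective [Finite ι] (b : Module.Basis ι ℂ V) :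
    Function.Injective (polyEval b) := by
  intro p q h
  refine MvPolynomial.funext fun x => ?_
  have := congrFun h (b.equivFun.symm x)
  rw [polyEval_apply, polyEval_apply] at this
  have hx : (fun i => b.coord i (b.equivFun.symm x)) = x := by
    funext i
    exact congrFun (b.equivFun.apply_symm_apply x) i
  rwa [hx] at this

/-! ### The Zariski topology -/

/-- The generating sets form a basis, since an intersection of two of them is the nonvanishing locus
of a product. -/
theorem exists_basicOpen_subset {O : Set (affineSpace V).carrier} (hO : IsOpen O)
    {v : (affineSpace V).carrier} (hv : v ∈ O) :
    ∃ p ∈ polynomialFunctions V, p v ≠ 0 ∧ ∀ w : V, p w ≠ 0 → w ∈ O := by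
  induction hO with
  | basic s hs =>
    obtain ⟨p, hp, rfl⟩ := hs
    exact ⟨p, hp, hv, fun w hw => hw⟩
  | univ => exact ⟨1, one_mem _, one_ne_zero, fun w _ => trivial⟩
  | inter s t _ _ hs ht =>
    obtain ⟨p, hp, hpv, hps⟩ := hs hv.1
    obtain ⟨q, hq, hqv, hqt⟩ := ht hv.2
    exact ⟨p * q, mul_mem hp hq, mul_ne_zero hpv hqv, fun w hw =>
      ⟨hps w (left_ne_zero_of_mul hw), hqt w (right_ne_zero_of_mul hw)⟩⟩
  | sUnion S _ hS =>
    obtain ⟨s, hs, hvs⟩ := hv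
    obtain ⟨p, hp, hpv, hps⟩ := hS s hs hvs
    exact ⟨p, hp, hpv, fun w hw => ⟨s, hs, hps w hw⟩⟩

theorem isOpen_basicOpen {p : V → ℂ} (hp : p ∈ polynomialFunctions V) :
    IsOpen (X := (affineSpace V).carrier) {v : V | p v ≠ 0} :=
  TopologicalSpace.isOpen_generateFrom_of_mem ⟨p, hp, rfl⟩

/-- Over an infinite field polynomial functions are the same as polynomials, which form a domain. -/
theorem polynomialFunctions_mul_ne_zero [FiniteDimensional ℂ V] {p q : V → ℂ}
    (hp : p ∈ polynomialFunctions V) (hq : q ∈ polynomialFunctions V) (hp0 : p ≠ 0) (hq0 : q ≠ 0) :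
    p * q ≠ 0 := by
  let b := Module.finBasis ℂ V
  obtain ⟨P, rfl⟩ := exists_polyEval_eq b hp
  obtain ⟨Q, rfl⟩ := exists_polyEval_eq b hq
  rw [← map_mul]
  rw [Ne, map_eq_zero_iff _ (polyEval_injective b)] at *
  exact mul_ne_zero hp0 hq0

instance irreducibleSpace_affineSpace [FiniteDimensional ℂ V] :
    IrreducibleSpace (affineSpace V).carrier where
  isPreirreducible_univ := by
    rintro O O' hO hO' ⟨v, -, hv⟩ ⟨v', -, hv'⟩
    obtain ⟨p, hp, hpv, hpO⟩ := exists_basicOpen_subset hO hv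
    obtain ⟨q, hq, hqv, hqO⟩ := exists_basicOpen_subset hO' hv'
    have := polynomialFunctions_mul_ne_zero hp hq (fun h => hpv (congrFun h v))
      (fun h => hqv (congrFun h v'))
    obtain ⟨w, hw⟩ := Function.ne_iff.1 this
    exact ⟨w, trivial, hpO w (left_ne_zero_of_mul hw), hqO w (right_ne_zero_of_mul hw)⟩
  toNonempty := ⟨(0 : V)⟩

/-! ### Regularity of affine space -/

/-- The local ring at $v$ is the localization of the polynomial ring at the kernel of evaluation at
$v$, and localizations of polynomial rings over a field at primes are regular. -/
theorem isRegularLocalRing_affineSpace [FiniteDimensional ℂ V] (v : (affineSpace V).carrier) :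
    IsRegularLocalRing ((affineSpace V).localRing v) := by
  let b := Module.finBasis ℂ V
  let R := MvPolynomial (Fin (Module.finrank ℂ V)) ℂ
  let ev : R →+* ℂ := MvPolynomial.eval fun i => b.coord i v
  have hev : ∀ p : R, ev p = polyEval b p v := fun p => (polyEval_apply b p v).symm
  let P : Ideal R := RingHom.ker ev
  have hP : P.IsPrime := RingHom.ker_isPrime ev
  let φ : R →+* (affineSpace V).localRing v :=
    { toFun := fun p => ⟨_, polyEval b p, isRegularAt_polynomial (polyEval_mem b p) v, rfl⟩
      map_one' := Subtype.ext (congrArg (Germ.ofFun) (map_one (polyEval b)))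
      map_zero' := Subtype.ext (congrArg (Germ.ofFun) (map_zero (polyEval b)))
      map_add' := fun p q => Subtype.ext (congrArg (Germ.ofFun) (map_add (polyEval b) p q))
      map_mul' := fun p q => Subtype.ext (congrArg (Germ.ofFun) (map_mul (polyEval b) p q)) }
  let _ : Algebra R ((affineSpace V).localRing v) := φ.toAlgebra
  have hloc : IsLocalization P.primeCompl ((affineSpace V).localRing v) := by
    rw [isLocalization_iff]
    refine ⟨?_, ?_, ?_⟩
    · rintro ⟨p, hp⟩
      have hp' : polyEval b p v ≠ 0 := by
        rw [← hev]
        exact hp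
      have hr := isRegularAt_polynomial (polyEval_mem b p) v
      obtain ⟨h1, h2⟩ := (affineSpace V).inv hr hp'
      refine IsUnit.of_mul_eq_one ⟨_, _, h2, rfl⟩ (Subtype.ext (Germ.coe_eq.2 ?_))
      filter_upwards [h1] with y hy
      exact mul_inv_cancel₀ hy
    · rintro ⟨_, k, ⟨f, hf, g, hg, hgv, he⟩, rfl⟩
      obtain ⟨p, rfl⟩ := exists_polyEval_eq b hf
      obtain ⟨q, rfl⟩ := exists_polyEval_eq b hg
      refine ⟨⟨p, q, ?_⟩, Subtype.ext (Germ.coe_eq.2 ?_)⟩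
      · change ev q ≠ 0
        rwa [hev]
      · filter_upwards [he, zariski_eventually (polyEval_mem b q) hgv] with y h1 h2
        change k y * polyEval b q y = polyEval b p y
        rw [h1, div_mul_cancel₀ _ h2]
    -- If $p=q$ near $v$, then $p=q$ wherever some polynomial $s$ with $s(v)\ne0$ is nonzero, so
    -- $sp=sq$ everywhere.
    · intro p q h
      have h' : polyEval b p =ᶠ[𝓝 v] polyEval b q := Germ.coe_eq.1 (congrArg Subtype.val h)
      obtain ⟨O, hO, hOo, hvO⟩ := eventually_nhds_iff.1 h'
      obtain ⟨f, hf, hfv, hfO⟩ := exists_basicOpen_subset hOo hvO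
      obtain ⟨s, rfl⟩ := exists_polyEval_eq b hf
      refine ⟨⟨s, ?_⟩, polyEval_injective b ?_⟩
      · change ev s ≠ 0
        rwa [hev]
      · funext w
        simp only [map_mul, Pi.mul_apply]
        by_cases hw : polyEval b s w = 0
        · simp [hw]
        · rw [hO w (hfO w hw)]
  exact .of_ringEquiv
    (IsLocalization.algEquiv P.primeCompl (Localization.AtPrime P)
      ((affineSpace V).localRing v)).toRingEquiv

/-! ### The dimension of affine space -/

/-- Taking vanishing ideals strictly reverses inclusions of irreducible closed sets and gives prime
ideals, so chains are bounded by the Krull dimension of the polynomial ring. The Nullstellensatz is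
not needed for this inequality. -/
theorem topologicalKrullDim_affineSpace_le [FiniteDimensional ℂ V] :
    topologicalKrullDim (affineSpace V).carrier ≤ Module.finrank ℂ V := by
  let b := Module.finBasis ℂ V
  let R := MvPolynomial (Fin (Module.finrank ℂ V)) ℂ
  have hR : ringKrullDim R = Module.finrank ℂ V := by simp [R]
  rw [← hR, ringKrullDim, ← Order.krullDim_orderDual]
  let I : TopologicalSpace.IrreducibleCloseds (affineSpace V).carrier → Ideal R := fun T =>
    ⨅ v ∈ T, RingHom.ker (MvPolynomial.eval fun i => b.coord i v)
  have hI : ∀ T p, p ∈ I T ↔ ∀ v ∈ T, polyEval b p v = 0 := by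
    intro T p
    simp only [I, Submodule.mem_iInf, RingHom.mem_ker]
    exact forall₂_congr fun (v : V) _ => by rw [polyEval_apply]
  have hprime : ∀ T, (I T).IsPrime := by
    intro T
    rw [Ideal.isPrime_iff]
    constructor
    · rw [Ne, Ideal.eq_top_iff_one, hI]
      intro h
      obtain ⟨(v : V), hv⟩ := T.isIrreducible.nonempty
      have := h v hv
      rw [polyEval_apply, map_one] at this
      exact one_ne_zero this
    · intro p q hpq
      by_contra! hc
      simp only [hI, not_forall] at hc
      obtain ⟨⟨v, hv, hpv⟩, w, hw, hqw⟩ := hc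
      obtain ⟨u, hu, hpu, hqu⟩ := T.isIrreducible.isPreirreducible _ _
        (isOpen_basicOpen (polyEval_mem b p)) (isOpen_basicOpen (polyEval_mem b q))
        ⟨v, hv, hpv⟩ ⟨w, hw, hqw⟩
      have := (hI _ _).1 hpq u hu
      rw [map_mul] at this
      exact (mul_eq_zero.1 this).elim hpu hqu
  have hle : ∀ T T', I T' ≤ I T → T ≤ T' := by
    intro T T' h v hv
    by_contra hv'
    obtain ⟨f, hf, hfv, hfO⟩ := exists_basicOpen_subset T'.isClosed.isOpen_compl hv'
    obtain ⟨p, rfl⟩ := exists_polyEval_eq b hf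
    have hp : p ∈ I T' := by
      refine (hI _ _).2 fun w hw => ?_
      by_contra h0
      exact hfO w h0 hw
    exact hfv ((hI _ _).1 (h hp) v hv)
  let F : TopologicalSpace.IrreducibleCloseds (affineSpace V).carrier → (PrimeSpectrum R)ᵒᵈ :=
    fun T => OrderDual.toDual ⟨I T, hprime T⟩
  refine Order.krullDim_le_of_strictMono F fun T T' h => ?_
  rw [lt_iff_le_not_ge]
  constructor
  · intro p hp
    exact (hI _ _).2 fun v hv => (hI _ _).1 hp v (h.le hv)
  · intro h'
    exact h.not_ge (hle _ _ h')

theorem isClosed_translate (W : Submodule ℂ V) (v : V) :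
    IsClosed (X := (affineSpace V).carrier) {w : V | w - v ∈ W} := by
  rw [← isOpen_compl_iff, isOpen_iff_forall_mem_open]
  intro (w : V) (hw : w - v ∉ W)
  obtain ⟨l, hl, hlW⟩ := Submodule.exists_le_ker_of_notMem hw
  -- A linear form that kills $W$ but not $w-v$ separates $w$ from the translate.
  refine ⟨{u : V | l u - l v ≠ 0}, fun (u : V) hu (hu' : u - v ∈ W) => hu ?_, isOpen_basicOpen (p := fun u => l u - l v)
    (sub_mem (linear_mem_polynomialFunctions l) ((polynomialFunctions V).algebraMap_mem (l v))), ?_⟩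
  · rw [← map_sub]
    exact hlW hu'
  · change l w - l v ≠ 0
    rwa [← map_sub]

theorem isIrreducible_translate [FiniteDimensional ℂ V] (W : Submodule ℂ V) (v : V) :
    IsIrreducible (X := (affineSpace V).carrier) {w : V | w - v ∈ W} := by
  let f : (affineSpace W).carrier → (affineSpace V).carrier := fun w => v + w.1
  have hf : Continuous f := continuous_iff_continuousAt.2 fun w => by
    refine (isMorphismAt_affineSpace fun l => ?_).1
    simp only [f, map_add]
    exact (affineSpace W).add ((affineSpace W).const _ _) (isRegularAt_linear (l ∘ₗ W.subtype) w)
  have := (IrreducibleSpace.isIrreducible_univ (affineSpace W).carrier).image f hf.continuousOn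
  convert this using 1
  ext (w : V)
  refine ⟨fun h => ⟨⟨w - v, h⟩, trivial, add_sub_cancel v w⟩, ?_⟩
  rintro ⟨y, -, rfl⟩
  change v + y.1 - v ∈ W
  rw [add_sub_cancel_left]
  exact y.2

/-- A complete flag of subspaces, translated to a point of $D$, is a chain of irreducible closed
sets all meeting $D$; such sets correspond to the irreducible closed subsets of $D$. -/
theorem finrank_le_topologicalKrullDim [FiniteDimensional ℂ V] {D : Set (affineSpace V).carrier}
    (hD : IsOpen D) (hne : D.Nonempty) : (Module.finrank ℂ V : WithBot ℕ∞) ≤ topologicalKrullDim D := by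
  obtain ⟨(v : V), hv⟩ := hne
  let b := Module.finBasis ℂ V
  let F : Fin (Module.finrank ℂ V + 1) →
      {T : TopologicalSpace.IrreducibleCloseds (affineSpace V).carrier //
        ((Subtype.val : D → (affineSpace V).carrier) ⁻¹' T).Nonempty} := fun k =>
    ⟨⟨_, isIrreducible_translate (b.flag k) v, isClosed_translate (b.flag k) v⟩, ⟨v, hv⟩, by
      change v - v ∈ b.flag k
      simp⟩
  have hF : StrictMono F := by
    intro k l hkl
    rw [lt_iff_le_not_ge]
    refine ⟨fun w hw => (b.flag_strictMono hkl).le hw, fun h => ?_⟩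
    refine (b.flag_strictMono hkl).not_ge fun (w : V) hw => ?_
    have : w + v ∈ {u : V | u - v ∈ b.flag k} := h (by
      change w + v - v ∈ b.flag l
      rwa [add_sub_cancel_right])
    change w + v - v ∈ b.flag k at this
    rwa [add_sub_cancel_right] at this
  rw [topologicalKrullDim, Order.krullDim_eq_of_orderIso
    (TopologicalSpace.IrreducibleCloseds.orderIsoOfIsOpenEmbedding _ hD.isOpenEmbedding_subtypeVal)]
  exact Order.LTSeries.length_le_krullDim (LTSeries.mk _ F hF)

end Affine

/-! ### Locally affine spaces -/

/-- Every point of `X` has an open neighbourhood isomorphic to an open subset of an affine space of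
dimension `n`. -/
def IsLocallyAffine (X : SpaceWithFunctions) (n : ℕ) : Prop :=
  ∀ x : X.carrier, ∃ U : Set X.carrier, IsOpen U ∧ x ∈ U ∧
    ∃ (V : Type) (_ : AddCommGroup V) (_ : Module ℂ V), FiniteDimensional ℂ V ∧
      Module.finrank ℂ V = n ∧ ∃ D : Set (affineSpace V).carrier, IsOpen D ∧
        Nonempty (Iso (X.restrict U) ((affineSpace V).restrict D))

theorem IsLocallyAffine.isNonsingular {n : ℕ} (hX : X.IsLocallyAffine n) : X.IsNonsingular := by
  intro x
  obtain ⟨U, hU, hxU, V, _, _, _, -, D, hD, ⟨Φ⟩⟩ := hX x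
  refine (isRegularLocalRing_restrict_iff hU ⟨x, hxU⟩).1 ((Φ.isRegularLocalRing_iff _).2 ?_)
  exact (isRegularLocalRing_restrict_iff hD _).2 (isRegularLocalRing_affineSpace _)

theorem IsLocallyAffine.topologicalKrullDim_eq {n : ℕ} (hX : X.IsLocallyAffine n)
    [hne : Nonempty X.carrier] : topologicalKrullDim X.carrier = n := by
  apply le_antisymm
  · refine iSup_le fun p => ?_
    -- A point of the smallest member lies on the whole chain, so a chart around it meets every
    -- member and the chain keeps its length there.
    obtain ⟨x, hx⟩ := (p 0).isIrreducible.nonempty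
    obtain ⟨U, hU, hxU, V, _, _, _, hn, D, hD, ⟨Φ⟩⟩ := hX x
    let q : LTSeries {T : TopologicalSpace.IrreducibleCloseds X.carrier //
        ((Subtype.val : U → X.carrier) ⁻¹' T).Nonempty} :=
      LTSeries.mk p.length (fun k => ⟨p k, ⟨x, hxU⟩, p.monotone (Fin.zero_le k) hx⟩)
        fun k l hkl => p.strictMono hkl
    have h1 : (p.length : WithBot ℕ∞) ≤ topologicalKrullDim U := by
      rw [topologicalKrullDim, Order.krullDim_eq_of_orderIso
        (TopologicalSpace.IrreducibleCloseds.orderIsoOfIsOpenEmbedding _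
          hU.isOpenEmbedding_subtypeVal)]
      exact Order.LTSeries.length_le_krullDim q
    have h2 : topologicalKrullDim U = topologicalKrullDim D :=
      Φ.toHomeomorph.isHomeomorph.topologicalKrullDim_eq
    calc (p.length : WithBot ℕ∞) ≤ topologicalKrullDim D := h2 ▸ h1
      _ ≤ topologicalKrullDim (affineSpace V).carrier := topologicalKrullDim_subspace_le _ _
      _ ≤ n := hn ▸ topologicalKrullDim_affineSpace_le
  · obtain ⟨x⟩ := hne
    obtain ⟨U, hU, hxU, V, _, _, _, hn, D, hD, ⟨Φ⟩⟩ := hX x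
    have h2 : topologicalKrullDim U = topologicalKrullDim D :=
      Φ.toHomeomorph.isHomeomorph.topologicalKrullDim_eq
    calc (n : WithBot ℕ∞) ≤ topologicalKrullDim D :=
          hn ▸ finrank_le_topologicalKrullDim hD ⟨_, (Φ.toHomeomorph ⟨x, hxU⟩).2⟩
      _ = topologicalKrullDim U := h2.symm
      _ ≤ topologicalKrullDim X.carrier := topologicalKrullDim_subspace_le _ _

end SpaceWithFunctions

/-! ### Open and closed loci, maps into vector spaces -/

namespace SpaceWithFunctions

variable {X Y Z : SpaceWithFunctions}

theorem isOpen_ne_zero {f : X.carrier → ℂ} (hf : ∀ x, X.IsRegularAt f x) :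
    IsOpen {x | f x ≠ 0} :=
  isOpen_iff_mem_nhds.2 fun x hx => IsRegularAt.eventually_ne (hf x) hx

theorem isClosed_eq_zero {f : X.carrier → ℂ} (hf : ∀ x, X.IsRegularAt f x) :
    IsClosed {x | f x = 0} :=
  ⟨isOpen_ne_zero hf⟩

section Affine

variable {V W : Type} [AddCommGroup V] [Module ℂ V] [AddCommGroup W] [Module ℂ W]

theorem isMorphismAt_linear (l : V →ₗ[ℂ] W) (v : (affineSpace V).carrier) :
    IsMorphismAt (affineSpace V) (affineSpace W) (fun v => l v) v :=
  isMorphismAt_affineSpace fun k => isRegularAt_linear (k ∘ₗ l) v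

theorem isMorphismAt_affineSpace_prod {f : Z.carrier → V} {g : Z.carrier → W} {z : Z.carrier}
    (hf : IsMorphismAt Z (affineSpace V) f z) (hg : IsMorphismAt Z (affineSpace W) g z) :
    IsMorphismAt Z (affineSpace (V × W)) (fun y => ((f y, g y) : V × W)) z := by
  refine isMorphismAt_affineSpace fun l => ?_
  have h : (fun y => l ((f y, g y) : V × W)) =
      fun y => (l ∘ₗ LinearMap.inl ℂ V W) (f y) + (l ∘ₗ LinearMap.inr ℂ V W) (g y) := by
    funext y
    simp [← map_add]
  rw [h]
  exact Z.add (hf.2 _ (isRegularAt_linear _ _)) (hg.2 _ (isRegularAt_linear _ _))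

theorem isMorphismAt_affineSpace_submodule {S : Submodule ℂ V} {f : Z.carrier → S} {z : Z.carrier}
    (hf : IsMorphismAt Z (affineSpace V) (fun y => (f y : V)) z) :
    IsMorphismAt Z (affineSpace S) f z := by
  refine isMorphismAt_affineSpace fun l => ?_
  obtain ⟨k, rfl⟩ := LinearMap.exists_extend l
  exact hf.2 _ (isRegularAt_linear k _)

theorem isMorphismAt_matrix {m n : Type} [Finite m] [Finite n] {f : Z.carrier → Matrix m n ℂ}
    {z : Z.carrier} (hf : ∀ i j, Z.IsRegularAt (fun y => f y i j) z) :
    IsMorphismAt Z (affineSpace (Matrix m n ℂ)) f z := by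
  have := Fintype.ofFinite m
  have := Fintype.ofFinite n
  classical
  refine isMorphismAt_affineSpace_basis (Matrix.stdBasis ℂ m n) fun i => ?_
  have h : (fun y => (Matrix.stdBasis ℂ m n).coord i (f y)) = fun y => f y i.1 i.2 := by
    funext y
    simp [Matrix.stdBasis]
  exact h ▸ hf i.1 i.2

theorem isRegularAt_apply {ι : Type} (i : ι) (v : (affineSpace (ι → ℂ)).carrier) :
    (affineSpace (ι → ℂ)).IsRegularAt (fun v : ι → ℂ => v i) v :=
  isRegularAt_linear (V := ι → ℂ) (LinearMap.proj i) v

end Affine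

/-! ### Affine charts of weighted projective spaces with weights `1` and `-1` -/

section Weighted

variable {ι : Type} {w : ι → ℤ}

theorem weightedProjectiveSpace.mk_eq_mk {v v' : ι → ℂ} {hv : v ≠ 0} {hv' : v' ≠ 0} :
    mk w v hv = mk w v' hv' ↔ weightedSetoid w v v' :=
  Quotient.eq (r := (weightedSetoid w).comap Subtype.val)

theorem weightedProjectiveSpace.exists_mk (q : (weightedProjectiveSpace w).carrier) :
    ∃ v hv, mk w v hv = q := by
  obtain ⟨⟨v, hv⟩, rfl⟩ := Quotient.exists_rep q
  exact ⟨v, hv, rfl⟩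

theorem isMorphismAt_weightedProjectiveSpace_of_lift
    {g : Z.carrier → (weightedProjectiveSpace w).carrier} {F : Z.carrier → ι → ℂ} {z : Z.carrier}
    (hF : IsMorphismAt Z (affineSpace (ι → ℂ)) F z)
    (h : ∀ᶠ y in 𝓝 z, ∃ hy : F y ≠ 0, g y = weightedProjectiveSpace.mk w (F y) hy) :
    IsMorphismAt Z (weightedProjectiveSpace w) g z :=
  isMorphismAt_quotient_restrict_of_lift hF h

theorem weightedProjectiveSpace.isOpen_of_isOpen {U : Set (weightedProjectiveSpace w).carrier}
    {O : Set (affineSpace (ι → ℂ)).carrier} (hO : IsOpen O)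
    (h : ∀ v hv, mk w v hv ∈ U ↔ v ∈ O) : IsOpen U := by
  refine isOpen_quotient_iff.2 ?_
  have ho : IsOpen (X := ((affineSpace (ι → ℂ)).restrict {v : ι → ℂ | v ≠ 0}).carrier)
      {x | x.1 ∈ O} := hO.preimage continuous_subtype_val
  convert ho using 1
  ext ⟨v, hv⟩
  exact h v hv

theorem weightedProjectiveSpace.isClosed_of_isClosed {C : Set (weightedProjectiveSpace w).carrier}
    {O : Set (affineSpace (ι → ℂ)).carrier} (hO : IsClosed O)
    (h : ∀ v hv, mk w v hv ∈ C ↔ v ∈ O) : IsClosed C :=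
  ⟨isOpen_of_isOpen hO.isOpen_compl fun v hv => not_congr (h v hv)⟩

/-- The section of `ℂ^ι ∖ {0} → ℙ(w)` over the set where the coordinate `a` does not vanish that takes
its values in the slice where this coordinate is `1`; for weights `w i = ± 1`. -/
noncomputable def weightedProjectiveSpace.chartSection (hw : ∀ i, w i = 1 ∨ w i = -1) (a : ι) :
    (weightedProjectiveSpace w).carrier → ι → ℂ :=
  -- This is the action of $t=v_a^{-w_a}$; for $i=a$ the exponent is $-w_a^2=-1$.
  Quotient.lift (fun v i => v.1 i * v.1 a ^ (-(w a * w i))) <| by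
    rintro ⟨v, hv⟩ ⟨v', hv'⟩ ⟨t, ht⟩
    funext i
    simp only at ht ⊢
    rw [ht i, ht a, mul_zpow, Units.val_zpow_eq_zpow_val, Units.val_zpow_eq_zpow_val]
    rcases hw a with ha | ha <;> rcases hw i with hi | hi <;> simp [ha, hi] <;> field_simp

variable {hw : ∀ i, w i = 1 ∨ w i = -1} {a : ι}

namespace weightedProjectiveSpace

theorem chartSection_mk (v : ι → ℂ) (hv : v ≠ 0) (i : ι) :
    chartSection hw a (mk w v hv) i = v i * v a ^ (-(w a * w i)) := rfl

/-- The coordinate $a$ of the section is $0$ or $1$, so its nonvanishing is a test for the domain of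
the chart that needs no representative. -/
theorem chartSection_mk_self_ne {v : ι → ℂ} {hv : v ≠ 0} :
    chartSection hw a (mk w v hv) a ≠ 0 ↔ v a ≠ 0 := by
  rw [chartSection_mk]
  constructor
  · exact left_ne_zero_of_mul
  · intro h
    exact mul_ne_zero h (zpow_ne_zero _ h)

theorem chartSection_self {q : (weightedProjectiveSpace w).carrier}
    (hq : chartSection hw a q a ≠ 0) : chartSection hw a q a = 1 := by
  obtain ⟨v, hv, rfl⟩ := exists_mk q
  have hva := chartSection_mk_self_ne.1 hq
  rw [chartSection_mk]
  rcases hw a with h | h <;> simp [h, hva]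

theorem chartSection_mk_of_eq_one {v : ι → ℂ} {hv : v ≠ 0} (h : v a = 1) :
    chartSection hw a (mk w v hv) = v := by
  funext i
  rw [chartSection_mk, h]
  simp

theorem mk_chartSection {q : (weightedProjectiveSpace w).carrier}
    (hq : chartSection hw a q a ≠ 0) :
    ∃ h : chartSection hw a q ≠ 0, mk w (chartSection hw a q) h = q := by
  refine ⟨fun h => hq (congrFun h a), ?_⟩
  obtain ⟨v, hv, rfl⟩ := exists_mk q
  have hva := chartSection_mk_self_ne.1 hq
  rw [mk_eq_mk]
  -- This scalar undoes the normalization by $v_a^{-w_a}$.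
  refine ⟨Units.mk0 (v a) hva ^ (w a), fun i => ?_⟩
  rw [chartSection_mk, ← zpow_mul, Units.val_zpow_eq_zpow_val, Units.val_mk0, mul_comm (v i),
    ← mul_assoc, ← zpow_add₀ hva]
  simp

theorem exists_chartSection_ne (q : (weightedProjectiveSpace w).carrier) :
    ∃ a, chartSection hw a q a ≠ 0 := by
  obtain ⟨v, hv, rfl⟩ := exists_mk q
  obtain ⟨a, ha⟩ := Function.ne_iff.1 hv
  exact ⟨a, chartSection_mk_self_ne.2 ha⟩

theorem isOpen_chartSection_ne : IsOpen {q | chartSection hw a q a ≠ 0} :=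
  isOpen_of_isOpen (isOpen_ne_zero (isRegularAt_apply a)) fun _ _ => chartSection_mk_self_ne

/-- The exponent of $v_a$ is always $\pm1$, so the components are products of coordinates and the
inverse of a nonvanishing one. -/
theorem isMorphismAt_chartSection [Finite ι] {q : (weightedProjectiveSpace w).carrier}
    (hq : chartSection hw a q a ≠ 0) :
    IsMorphismAt (weightedProjectiveSpace w) (affineSpace (ι → ℂ)) (chartSection hw a) q := by
  refine isMorphismAt_of_quotient isOpen_chartSection_ne ?_ hq
  rintro ⟨v, hv⟩ hva
  replace hva : v a ≠ 0 := chartSection_mk_self_ne.1 hva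
  refine isMorphismAt_pi fun i => ?_
  have hr : ∀ i, ((affineSpace (ι → ℂ)).restrict {v : ι → ℂ | v ≠ 0}).IsRegularAt
      (fun v => v.1 i) ⟨v, hv⟩ := fun i =>
    (isMorphismAt_subtype_val (X := affineSpace (ι → ℂ)) {v : ι → ℂ | v ≠ 0} ⟨v, hv⟩).2 _
      (isRegularAt_apply i v)
  have hz : ((affineSpace (ι → ℂ)).restrict {v : ι → ℂ | v ≠ 0}).IsRegularAt
      (fun v => v.1 a ^ (-(w a * w i))) ⟨v, hv⟩ := by
    have : -(w a * w i) = 1 ∨ -(w a * w i) = -1 := by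
      rcases hw a with h | h <;> rcases hw i with h' | h' <;> simp [h, h']
    rcases this with h | h
    · rw [h]
      simpa using hr a
    · rw [h]
      simpa using! (SpaceWithFunctions.inv _ (hr a) hva).2
  exact SpaceWithFunctions.mul _ (hr i) hz

end weightedProjectiveSpace

end Weighted

end SpaceWithFunctions

namespace ADHM

open SpaceWithFunctions

variable {d r : ℕ}

/-! ### Charge one: coordinates -/

/-- The matrix with rows `I_k`. -/
def pairIMatrix (v : PairIndex d r → ℂ) : Matrix (Fin (d + 1)) (Fin r) ℂ :=
  Matrix.of fun k i => v (Sum.inl (k, i))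

/-- The matrix with columns `J_k`. -/
def pairJMatrix (v : PairIndex d r → ℂ) : Matrix (Fin r) (Fin (d + 1)) ℂ :=
  Matrix.of fun i k => v (Sum.inr (k, i))

/-- The symmetric form of the equations; the diagonal ones appear doubled, which is harmless in
characteristic $0$. -/
theorem pairEquations_iff_forall {v : PairIndex d r → ℂ} :
    PairEquations v ↔ ∀ k m, dotProduct (pairI v k) (pairJ v m) +
      dotProduct (pairI v m) (pairJ v k) = 0 := by
  constructor
  · rintro ⟨h1, h2⟩ k m
    rcases lt_trichotomy k m with h | rfl | h
    · exact h2 k m h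
    · rw [h1, add_zero]
    · rw [add_comm]
      exact h2 m k h
  · intro h
    exact ⟨fun k => self_eq_neg.1 (eq_neg_of_add_eq_zero_left (h k k)), fun k m _ => h k m⟩

/-- The solutions of the pair equations for which the `I_k` are linearly independent. -/
def independentPairs (d r : ℕ) : Set (PairIndex d r → ℂ) :=
  {v | PairEquations v ∧ LinearIndependent ℂ (pairI v)}

theorem pair_ne_zero_of_linearIndependent {v : PairIndex d r → ℂ}
    (hv : LinearIndependent ℂ (pairI v)) : v ≠ 0 := by
  rintro rfl
  exact hv.ne_zero 0 rfl

/-- A polynomial over $\mathbb C$ is determined by its values. Evaluating the quadratic form $\sum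
z_kz_mI_kJ_m$ at $e_k$ and $e_k+e_m$ yields the equations. -/
theorem isSolution_iff (X : Datum d r 1) : X.IsSolution ↔ PairEquations (ijCoords X) := by
  have hentry : ∀ (M : Fin (d + 1) → Matrix (Fin 1) (Fin r) ℂ) (N : Fin (d + 1) →
      Matrix (Fin r) (Fin 1) ℂ) (z : Fin (d + 1) → ℂ),
      MvPolynomial.eval z ((linearForm M * linearForm N) 0 0) =
        ∑ k, ∑ m, z k * z m * ∑ i, M k 0 i * N m i 0 := by
    intro M N z
    simp only [Matrix.mul_apply, linearForm, Matrix.sum_apply, Matrix.smul_apply, Matrix.map_apply,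
      smul_eq_mul, map_sum, map_mul, MvPolynomial.eval_X, MvPolynomial.eval_C]
    simp only [Finset.sum_mul_sum]
    rw [Finset.sum_comm]
    refine Finset.sum_congr rfl fun k _ => ?_
    rw [Finset.sum_comm]
    refine Finset.sum_congr rfl fun m _ => ?_
    rw [Finset.mul_sum]
    exact Finset.sum_congr rfl fun i _ => by ring
  have hb : ∀ k m, ∑ i, X.I k 0 i * X.J m i 0 =
      dotProduct (pairI (ijCoords X) k) (pairJ (ijCoords X) m) := fun _ _ => rfl
  have hX : X.IsSolution ↔ ∀ z : Fin (d + 1) → ℂ,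
      ∑ k, ∑ m, z k * z m * dotProduct (pairI (ijCoords X) k) (pairJ (ijCoords X) m) = 0 := by
    have hc : linearForm X.A * linearForm X.B - linearForm X.B * linearForm X.A = 0 := by
      ext i j : 2
      rw [Subsingleton.elim i 0, Subsingleton.elim j 0]
      simp [Matrix.mul_apply, mul_comm]
    rw [Datum.IsSolution, hc, zero_add]
    constructor
    · intro h z
      have := congrArg (MvPolynomial.eval z) (congrFun (congrFun h 0) 0)
      rw [hentry] at this
      simpa only [hb, Matrix.zero_apply, map_zero] using this
    · intro h
      refine Matrix.ext fun i j => ?_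
      rw [Subsingleton.elim i 0, Subsingleton.elim j 0]
      refine MvPolynomial.funext fun z => ?_
      rw [hentry]
      simpa only [hb, Matrix.zero_apply, map_zero] using h z
  rw [hX]
  constructor
  · intro h
    have h1 : ∀ k, dotProduct (pairI (ijCoords X) k) (pairJ (ijCoords X) k) = 0 := by
      intro k
      simpa [Pi.single_apply] using h (Pi.single k 1)
    refine ⟨h1, fun k m hkm => ?_⟩
    have := h (Pi.single k 1 + Pi.single m 1)
    simpa [Pi.single_apply, add_mul, mul_add, Finset.sum_add_distrib, h1,
      add_comm] using this
  · intro h z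
    rw [pairEquations_iff_forall] at h
    -- Adding the sum to itself with $k,m$ exchanged gives a sum that vanishes term by term.
    refine self_eq_neg.1 (eq_neg_of_add_eq_zero_left ?_)
    nth_rw 2 [Finset.sum_comm]
    simp only [← Finset.sum_add_distrib]
    refine Finset.sum_eq_zero fun k _ => Finset.sum_eq_zero fun m _ => ?_
    rw [mul_comm (z m), ← mul_add, h, mul_zero]

/-- The only proper subspace of a line is $0$, which is invariant under everything and contains the
image of $I$ exactly when $I=0$. -/
theorem isStable_iff_of_charge_one (Y : Quadruple r 1) : Y.IsStable ↔ Y.2.2.1 ≠ 0 := by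
  constructor
  · intro h h0
    have := h ⊥ (by simp) (by simp) (by simp [h0])
    exact bot_ne_top this
  · intro h S _ _ hS
    obtain ⟨j, i, hi⟩ : ∃ j i, Y.2.2.1 j i ≠ 0 := by
      by_contra! hc
      exact h (Matrix.ext hc)
    have hmem := hS (Pi.single i 1)
    rw [Matrix.mulVec_single_one] at hmem
    rw [eq_top_iff]
    intro v _
    have hv : v = (v 0 / Y.2.2.1 j i) • Y.2.2.1.col i := by
      funext l
      rw [Subsingleton.elim l 0, Subsingleton.elim j 0] at *
      simp [hi]
    rw [hv]
    exact S.smul_mem _ hmem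

theorem isGloballyStable_iff (X : Datum d r 1) :
    X.IsGloballyStable ↔ LinearIndependent ℂ (pairI (ijCoords X)) := by
  have h : ∀ p : Fin (d + 1) → ℂ, (∑ k, p k • X k).2.2.1 = 0 ↔
      ∑ k, p k • pairI (ijCoords X) k = 0 := by
    intro p
    have h1 : (∑ k, p k • X k).2.2.1 = ∑ k, p k • X.I k := by
      simp [Prod.snd_sum, Prod.fst_sum, Datum.I]
    rw [h1, ← Matrix.ext_iff, funext_iff]
    simp [Fin.forall_fin_one, Matrix.sum_apply, pairI, ijCoords]
  rw [Fintype.linearIndependent_iff]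
  simp only [Datum.IsGloballyStable, isStable_iff_of_charge_one, Ne, h]
  constructor
  · intro h p hp
    by_contra hc
    exact h p (fun h0 => hc fun i => congrFun h0 i) hp
  · intro h p hp0 hp
    exact hp0 (funext (h p hp))

theorem mem_globallyStableSolutions_iff (X : Datum d r 1) :
    X ∈ globallyStableSolutions d r 1 ↔ ijCoords X ∈ independentPairs d r :=
  and_congr (isSolution_iff X) (isGloballyStable_iff X)

/-- The charge-one datum with given coordinates. -/
def ofCoords (d r : ℕ) :
    ((Fin (d + 1) ⊕ Fin (d + 1) → ℂ) × (PairIndex d r → ℂ)) →ₗ[ℂ] Datum d r 1 where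
  toFun p := fun k => (Matrix.of fun _ _ => p.1 (Sum.inl k), Matrix.of fun _ _ => p.1 (Sum.inr k),
    Matrix.of fun _ i => p.2 (Sum.inl (k, i)), Matrix.of fun i _ => p.2 (Sum.inr (k, i)))
  map_add' _ _ := rfl
  map_smul' _ _ := rfl

@[simp]
theorem abCoords_ofCoords (u : Fin (d + 1) ⊕ Fin (d + 1) → ℂ) (v : PairIndex d r → ℂ) :
    abCoords (ofCoords d r (u, v)) = u := by
  funext i
  rcases i with i | i <;> rfl

@[simp]
theorem ijCoords_ofCoords (u : Fin (d + 1) ⊕ Fin (d + 1) → ℂ) (v : PairIndex d r → ℂ) :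
    ijCoords (ofCoords d r (u, v)) = v := by
  funext i
  rcases i with i | i <;> rfl

theorem ofCoords_abCoords_ijCoords (X : Datum d r 1) :
    ofCoords d r (abCoords X, ijCoords X) = X := by
  funext k
  refine Prod.ext ?_ (Prod.ext ?_ (Prod.ext ?_ ?_)) <;> ext i j
  · rw [Subsingleton.elim i 0, Subsingleton.elim j 0]
    rfl
  · rw [Subsingleton.elim i 0, Subsingleton.elim j 0]
    rfl
  · rw [Subsingleton.elim i 0]
    rfl
  · rw [Subsingleton.elim j 0]
    rfl

theorem isRegularAt_abCoords (i : Fin (d + 1) ⊕ Fin (d + 1))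
    (X : (affineSpace (Datum d r 1)).carrier) :
    (affineSpace (Datum d r 1)).IsRegularAt (fun X => abCoords (r := r) X i) X := by
  let l : Datum d r 1 →ₗ[ℂ] ℂ :=
    { toFun := fun X => abCoords X i
      map_add' := fun _ _ => by rcases i with i | i <;> rfl
      map_smul' := fun _ _ => by rcases i with i | i <;> rfl }
  exact isRegularAt_linear l X

theorem isRegularAt_ijCoords (i : PairIndex d r) (X : (affineSpace (Datum d r 1)).carrier) :
    (affineSpace (Datum d r 1)).IsRegularAt (fun X => ijCoords (d := d) X i) X := by
  let l : Datum d r 1 →ₗ[ℂ] ℂ :=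
    { toFun := fun X => ijCoords X i
      map_add' := fun _ _ => by rcases i with i | i <;> rfl
      map_smul' := fun _ _ => by rcases i with i | i <;> rfl }
  exact isRegularAt_linear l X

/-! ### Charge one: orbits -/

theorem pairWeights_eq (i : PairIndex d r) : pairWeights d r i = 1 ∨ pairWeights d r i = -1 := by
  rcases i with i | i
  · exact Or.inl rfl
  · exact Or.inr rfl

/-- $GL_1$ is commutative, so conjugation is trivial on $A,B$, while $I$ and $J$ are scaled by $g$
and $g^{-1}$. -/
theorem gaugeSetoid_iff (X X' : Datum d r 1) : gaugeSetoid d r 1 X X' ↔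
    abCoords X = abCoords X' ∧ weightedSetoid (pairWeights d r) (ijCoords X) (ijCoords X') := by
  constructor
  · rintro ⟨g, rfl⟩
    have hg : g.val 0 0 * g⁻¹.val 0 0 = 1 := by
      have := congrArg (fun M : Matrix (Fin 1) (Fin 1) ℂ => M 0 0) g.mul_inv
      simpa only [Matrix.mul_apply, Fin.sum_univ_one, Matrix.one_apply_eq] using this
    have hg' : g⁻¹.val 0 0 * g.val 0 0 = 1 := by rw [mul_comm, hg]
    refine ⟨?_, ⟨g.val 0 0, g⁻¹.val 0 0, hg, hg'⟩, ?_⟩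
    · funext i
      rcases i with i | i
      · simp only [abCoords, gaugeAction, Datum.A, Matrix.mul_apply, Fin.sum_univ_one, Sum.elim_inl]
        rw [mul_right_comm, hg, one_mul]
      · simp only [abCoords, gaugeAction, Datum.B, Matrix.mul_apply, Fin.sum_univ_one, Sum.elim_inr]
        rw [mul_right_comm, hg, one_mul]
    · rintro (i | i)
      · simp [ijCoords, gaugeAction, Datum.I, Matrix.mul_apply, pairWeights]
      · simp [ijCoords, gaugeAction, Datum.J, Matrix.mul_apply, pairWeights, mul_comm]
  · rintro ⟨hu, t, ht⟩
    refine ⟨Units.map (Matrix.scalar (Fin 1) : ℂ →+* _).toMonoidHom t, ?_⟩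
    have hA : ∀ k, X.A k 0 0 = X'.A k 0 0 := fun k => congrFun hu (Sum.inl k)
    have hB : ∀ k, X.B k 0 0 = X'.B k 0 0 := fun k => congrFun hu (Sum.inr k)
    have hI : ∀ k j, X'.I k 0 j = t * X.I k 0 j := fun k j => by
      simpa [pairWeights, ijCoords] using ht (Sum.inl (k, j))
    have hJ : ∀ k j, X'.J k j 0 = (t : ℂ)⁻¹ * X.J k j 0 := fun k j => by
      simpa [pairWeights, ijCoords] using ht (Sum.inr (k, j))
    funext k
    refine Prod.ext ?_ (Prod.ext ?_ (Prod.ext ?_ ?_)) <;> ext i j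
    · rw [Subsingleton.elim i 0, Subsingleton.elim j 0]
      refine (hA k).symm.trans ?_
      simp [gaugeAction, Matrix.mul_apply, mul_right_comm]
    · rw [Subsingleton.elim i 0, Subsingleton.elim j 0]
      refine (hB k).symm.trans ?_
      simp [gaugeAction, Matrix.mul_apply, mul_right_comm]
    · rw [Subsingleton.elim i 0]
      refine (hI k j).trans ?_
      simp [gaugeAction, Matrix.mul_apply]
    · rw [Subsingleton.elim j 0]
      refine (hJ k i).trans ?_
      simp [gaugeAction, Matrix.mul_apply, mul_comm]

theorem mem_independentPairs_of_weightedSetoid {v v' : PairIndex d r → ℂ}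
    (h : weightedSetoid (pairWeights d r) v v') (hv : v ∈ independentPairs d r) :
    v' ∈ independentPairs d r := by
  obtain ⟨t, ht⟩ := h
  have hI : pairI v' = fun k => t • pairI v k := by
    funext k i
    simpa [pairWeights, pairI, Units.smul_def] using ht (Sum.inl (k, i))
  have hJ : pairJ v' = fun k => t⁻¹ • pairJ v k := by
    funext k i
    simpa [pairWeights, pairJ, Units.smul_def] using ht (Sum.inr (k, i))
  refine ⟨?_, ?_⟩
  · rw [pairEquations_iff_forall]
    intro k m
    simpa [hI, hJ, smul_dotProduct, dotProduct_smul] using pairEquations_iff_forall.1 hv.1 k m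
  · rw [hI]
    exact hv.2.units_smul fun _ => t

theorem independentPairSolutions_mk {v : PairIndex d r → ℂ} {hv : v ≠ 0} :
    weightedProjectiveSpace.mk (pairWeights d r) v hv ∈ independentPairSolutions d r ↔
      v ∈ independentPairs d r := by
  constructor
  · rintro ⟨v', hv', h, hE, hL⟩
    exact mem_independentPairs_of_weightedSetoid (weightedProjectiveSpace.mk_eq_mk.1 h) ⟨hE, hL⟩
  · rintro ⟨hE, hL⟩
    exact ⟨v, hv, rfl, hE, hL⟩

namespace moduliGS

/-- The point of the moduli space with given coordinates. -/
def ofPair (u : Fin (d + 1) ⊕ Fin (d + 1) → ℂ) (v : PairIndex d r → ℂ)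
    (hv : v ∈ independentPairs d r) : (moduliGS d r 1).carrier :=
  mk (ofCoords d r (u, v))
    ((mem_globallyStableSolutions_iff _).2 (by rwa [ijCoords_ofCoords]))

theorem mk_eq_mk {X X' : Datum d r 1} {hX : X ∈ globallyStableSolutions d r 1}
    {hX' : X' ∈ globallyStableSolutions d r 1} :
    mk X hX = mk X' hX' ↔ gaugeSetoid d r 1 X X' :=
  Quotient.eq (r := (gaugeSetoid d r 1).comap Subtype.val)

theorem ofPair_eq_ofPair {u u' : Fin (d + 1) ⊕ Fin (d + 1) → ℂ} {v v' : PairIndex d r → ℂ}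
    {hv : v ∈ independentPairs d r} {hv' : v' ∈ independentPairs d r} :
    ofPair u v hv = ofPair u' v' hv' ↔ u = u' ∧ weightedSetoid (pairWeights d r) v v' := by
  rw [ofPair, ofPair, mk_eq_mk, gaugeSetoid_iff]
  simp only [abCoords_ofCoords, ijCoords_ofCoords]

theorem mk_eq_ofPair (X : Datum d r 1) (hX : X ∈ globallyStableSolutions d r 1) :
    mk X hX = ofPair (abCoords X) (ijCoords X) ((mem_globallyStableSolutions_iff _).1 hX) := by
  simp only [ofPair, ofCoords_abCoords_ijCoords]

theorem exists_ofPair (q : (moduliGS d r 1).carrier) : ∃ u v hv, ofPair u v hv = q := by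
  obtain ⟨⟨X, hX⟩, rfl⟩ := Quotient.exists_rep q
  exact ⟨_, _, _, (mk_eq_ofPair X hX).symm⟩

/-- A map to the moduli space that has a regular lift to coordinates is a morphism. -/
theorem isMorphismAt_of_lift {Z : SpaceWithFunctions} {g : Z.carrier → (moduliGS d r 1).carrier}
    {u : Z.carrier → Fin (d + 1) ⊕ Fin (d + 1) → ℂ} {v : Z.carrier → PairIndex d r → ℂ}
    {z : Z.carrier} (hu : ∀ i, Z.IsRegularAt (fun y => u y i) z)
    (hv : ∀ i, Z.IsRegularAt (fun y => v y i) z)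
    (h : ∀ᶠ y in 𝓝 z, ∃ hy : v y ∈ independentPairs d r, g y = ofPair (u y) (v y) hy) :
    IsMorphismAt Z (moduliGS d r 1) g z := by
  refine isMorphismAt_quotient_restrict_of_lift (F := fun y => ofCoords d r (u y, v y)) ?_ ?_
  · exact (isMorphismAt_linear (ofCoords d r) _).comp
      (isMorphismAt_affineSpace_prod (isMorphismAt_pi hu) (isMorphismAt_pi hv))
  · filter_upwards [h] with y hy
    obtain ⟨hy, hg⟩ := hy
    exact ⟨_, hg⟩

/-- A map from the moduli space is a morphism if it is so in coordinates. -/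
theorem isMorphismAt_of_comp {Y : SpaceWithFunctions} {f : (moduliGS d r 1).carrier → Y.carrier}
    (hf : ∀ X : ((affineSpace (Datum d r 1)).restrict (globallyStableSolutions d r 1)).carrier,
      IsMorphismAt ((affineSpace (Datum d r 1)).restrict (globallyStableSolutions d r 1)) Y
        (fun X => f (mk X.1 X.2)) X) (q : (moduliGS d r 1).carrier) :
    IsMorphismAt (moduliGS d r 1) Y f q :=
  isMorphismAt_of_quotient isOpen_univ (fun X _ => hf X) trivial

/-- The numbers `(A_k, B_k)` on the moduli space. -/
def ab : (moduliGS d r 1).carrier → Fin (d + 1) ⊕ Fin (d + 1) → ℂ :=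
  Quotient.lift (fun X => abCoords X.1) fun _ _ h => ((gaugeSetoid_iff _ _).1 h).1

theorem ab_mk (X : Datum d r 1) (hX : X ∈ globallyStableSolutions d r 1) :
    ab (mk X hX) = abCoords X := rfl

theorem ijCoords_ne_zero {X : Datum d r 1} (hX : X ∈ globallyStableSolutions d r 1) :
    ijCoords X ≠ 0 :=
  pair_ne_zero_of_linearIndependent ((mem_globallyStableSolutions_iff X).1 hX).2

/-- The class `[I, J]` in the weighted projective space. -/
def ij : (moduliGS d r 1).carrier → (pairSpace d r).carrier :=
  Quotient.lift (fun X => weightedProjectiveSpace.mk _ (ijCoords X.1) (ijCoords_ne_zero X.2))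
    fun _ _ h => weightedProjectiveSpace.mk_eq_mk.2 ((gaugeSetoid_iff _ _).1 h).2

theorem ij_mk (X : Datum d r 1) (hX : X ∈ globallyStableSolutions d r 1) :
    ij (mk X hX) = weightedProjectiveSpace.mk _ (ijCoords X) (ijCoords_ne_zero hX) := rfl

theorem ab_ofPair {u : Fin (d + 1) ⊕ Fin (d + 1) → ℂ} {v : PairIndex d r → ℂ}
    {hv : v ∈ independentPairs d r} : ab (ofPair u v hv) = u := by
  rw [ofPair, ab_mk, abCoords_ofCoords]

theorem ij_ofPair {u : Fin (d + 1) ⊕ Fin (d + 1) → ℂ} {v : PairIndex d r → ℂ}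
    {hv : v ∈ independentPairs d r} :
    ij (ofPair u v hv) =
      weightedProjectiveSpace.mk _ v (pair_ne_zero_of_linearIndependent hv.2) := by
  rw [ofPair, ij_mk]
  congr 1
  exact ijCoords_ofCoords u v

theorem ij_mem (q : (moduliGS d r 1).carrier) : ij q ∈ independentPairSolutions d r := by
  obtain ⟨u, v, hv, rfl⟩ := exists_ofPair q
  rw [ij_ofPair]
  exact independentPairSolutions_mk.2 hv

theorem isRegularAt_subtype_abCoords (i : Fin (d + 1) ⊕ Fin (d + 1))
    (X : ((affineSpace (Datum d r 1)).restrict (globallyStableSolutions d r 1)).carrier) :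
    ((affineSpace (Datum d r 1)).restrict (globallyStableSolutions d r 1)).IsRegularAt
      (fun X => abCoords X.1 i) X :=
  (isMorphismAt_subtype_val (X := affineSpace (Datum d r 1)) (globallyStableSolutions d r 1) X).2 _
    (isRegularAt_abCoords i X.1)

theorem isRegularAt_subtype_ijCoords (i : PairIndex d r)
    (X : ((affineSpace (Datum d r 1)).restrict (globallyStableSolutions d r 1)).carrier) :
    ((affineSpace (Datum d r 1)).restrict (globallyStableSolutions d r 1)).IsRegularAt
      (fun X => ijCoords X.1 i) X :=
  (isMorphismAt_subtype_val (X := affineSpace (Datum d r 1)) (globallyStableSolutions d r 1) X).2 _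
    (isRegularAt_ijCoords i X.1)

theorem isMorphismAt_ab (q : (moduliGS d r 1).carrier) :
    IsMorphismAt (moduliGS d r 1) (affineSpace (Fin (d + 1) ⊕ Fin (d + 1) → ℂ)) ab q :=
  isMorphismAt_of_comp (fun X => isMorphismAt_pi fun i => isRegularAt_subtype_abCoords i X) q

theorem isMorphismAt_ij (q : (moduliGS d r 1).carrier) :
    IsMorphismAt (moduliGS d r 1) (pairSpace d r) ij q :=
  isMorphismAt_of_comp (fun X => isMorphismAt_weightedProjectiveSpace_of_lift
    (isMorphismAt_pi fun i => isRegularAt_subtype_ijCoords i X)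
    (Eventually.of_forall fun _ => ⟨_, rfl⟩)) q

end moduliGS

/-! ### The isomorphism with the product -/

theorem chartSection_mem_independentPairs {a : PairIndex d r} {q : (pairSpace d r).carrier}
    (hq : q ∈ independentPairSolutions d r)
    (ha : weightedProjectiveSpace.chartSection pairWeights_eq a q a ≠ 0) :
    weightedProjectiveSpace.chartSection pairWeights_eq a q ∈ independentPairs d r := by
  obtain ⟨h, h'⟩ := weightedProjectiveSpace.mk_chartSection ha
  rw [← h'] at hq
  exact independentPairSolutions_mk.1 hq

theorem exists_independentPairs_mk {q : (pairSpace d r).carrier}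
    (hq : q ∈ independentPairSolutions d r) : ∃ (v : PairIndex d r → ℂ) (hv : v ≠ 0),
      weightedProjectiveSpace.mk (pairWeights d r) v hv = q ∧ v ∈ independentPairs d r := hq

/-- The point of the moduli space given by a point of the model. -/
noncomputable def chargeOneModel.toModuli (p : (chargeOneModel d r).carrier) :
    (moduliGS d r 1).carrier :=
  moduliGS.ofPair p.1 (exists_independentPairs_mk p.2.2).choose
    (exists_independentPairs_mk p.2.2).choose_spec.choose_spec.2

/-- The chosen representative is immaterial, so it can be exchanged for a regularly varying one. -/
theorem chargeOneModel.toModuli_eq {p : (chargeOneModel d r).carrier} {v : PairIndex d r → ℂ}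
    (hv : v ≠ 0) (h : weightedProjectiveSpace.mk (pairWeights d r) v hv = p.2.1)
    (hS : v ∈ independentPairs d r) : toModuli p = moduliGS.ofPair p.1 v hS := by
  refine moduliGS.ofPair_eq_ofPair.2 ⟨rfl, ?_⟩
  obtain ⟨hv', h', -⟩ := (exists_independentPairs_mk p.2.2).choose_spec
  rw [← weightedProjectiveSpace.mk_eq_mk (hv := hv') (hv' := hv), h, h']

/-- Near $p$ the representative normalized at a nonzero coordinate is a regular lift. -/
theorem chargeOneModel.isMorphismAt_toModuli (p : (chargeOneModel d r).carrier) :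
    IsMorphismAt (chargeOneModel d r) (moduliGS d r 1) toModuli p := by
  obtain ⟨a, ha⟩ := weightedProjectiveSpace.exists_chartSection_ne (hw := pairWeights_eq) p.2.1
  have h1 : IsMorphismAt (chargeOneModel d r) (affineSpace (Fin (d + 1) ⊕ Fin (d + 1) → ℂ))
      Prod.fst p := isMorphismAt_fst p
  have h2 : IsMorphismAt (chargeOneModel d r) (pairSpace d r) (fun p => p.2.1) p :=
    (isMorphismAt_subtype_val (X := pairSpace d r) (independentPairSolutions d r) p.2).comp
      (isMorphismAt_snd p)
  have h3 : IsMorphismAt (chargeOneModel d r) (affineSpace (PairIndex d r → ℂ))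
      (fun p => weightedProjectiveSpace.chartSection pairWeights_eq a p.2.1) p :=
    IsMorphismAt.comp (Y := pairSpace d r)
      (weightedProjectiveSpace.isMorphismAt_chartSection ha) h2
  refine moduliGS.isMorphismAt_of_lift (fun i => h1.2 _ (isRegularAt_apply i _))
    (fun i => h3.2 _ (isRegularAt_apply i _)) ?_
  filter_upwards [h2.1.preimage_mem_nhds
    (weightedProjectiveSpace.isOpen_chartSection_ne.mem_nhds ha)] with y hy
  obtain ⟨hne, he⟩ := weightedProjectiveSpace.mk_chartSection hy
  exact ⟨chartSection_mem_independentPairs y.2.2 hy, toModuli_eq hne he _⟩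

/-- The isomorphism `[A, B, I, J] ↦ ((A, B), [I, J])`. -/
noncomputable def moduliGSIso (d r : ℕ) : Iso (moduliGS d r 1) (chargeOneModel d r) :=
  Iso.ofInverse (fun q => (moduliGS.ab q, ⟨moduliGS.ij q, moduliGS.ij_mem q⟩))
    chargeOneModel.toModuli
    (fun q => by
      obtain ⟨u, v, hv, rfl⟩ := moduliGS.exists_ofPair q
      exact (chargeOneModel.toModuli_eq (pair_ne_zero_of_linearIndependent hv.2)
        (moduliGS.ij_ofPair (hv := hv)).symm hv).trans
          (moduliGS.ofPair_eq_ofPair.2 ⟨moduliGS.ab_ofPair (hv := hv), (weightedSetoid _).refl _⟩))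
    (fun p => by
      obtain ⟨v, hv, h, hS⟩ := exists_independentPairs_mk p.2.2
      have h1 : moduliGS.ab (chargeOneModel.toModuli p) = p.1 := by
        rw [chargeOneModel.toModuli_eq hv h hS]
        exact moduliGS.ab_ofPair
      have h2 : moduliGS.ij (chargeOneModel.toModuli p) = p.2.1 := by
        rw [chargeOneModel.toModuli_eq hv h hS]
        exact moduliGS.ij_ofPair.trans h
      exact Prod.ext h1 (Subtype.ext h2))
    (fun q => (moduliGS.isMorphismAt_ab q).prodMk (moduliGS.isMorphismAt_ij q).codRestrict)
    chargeOneModel.isMorphismAt_toModuli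

/-! ### Openness of linear independence -/

/-- Independence of the rows makes $x\mapsto xI$ injective; $N$ is the matrix of a left inverse of
this map. -/
theorem exists_rightInverse_of_linearIndependent {I : Matrix (Fin (d + 1)) (Fin r) ℂ}
    (hI : LinearIndependent ℂ I.row) : ∃ N : Matrix (Fin r) (Fin (d + 1)) ℂ, I * N = 1 := by
  have hker := LinearIndependent.fintypeLinearCombination_injective hI
  obtain ⟨g, hg⟩ := LinearMap.exists_leftInverse_of_injective _ (LinearMap.ker_eq_bot.2 hker)
  refine ⟨Matrix.of fun i k => g (Pi.single i 1) k, ?_⟩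
  ext k m
  have h := congrFun (LinearMap.congr_fun hg (Pi.single k 1)) m
  have hk : I k = ∑ i, I k i • Pi.single (M := fun _ => ℂ) i 1 := by
    rw [← pi_eq_sum_univ']
  simp only [LinearMap.comp_apply, Fintype.linearCombination_apply_single, one_smul,
    Matrix.row_apply', LinearMap.id_apply] at h
  rw [hk] at h
  simpa [Matrix.mul_apply, Matrix.one_apply, Pi.single_apply, eq_comm] using h

theorem linearIndependent_of_det_ne_zero {I : Matrix (Fin (d + 1)) (Fin r) ℂ}
    {N : Matrix (Fin r) (Fin (d + 1)) ℂ} (h : (I * N).det ≠ 0) : LinearIndependent ℂ I.row := by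
  have h1 : LinearIndependent ℂ (I * N).row := Matrix.linearIndependent_rows_of_det_ne_zero h
  have h2 : (I * N).row = N.vecMulLinear ∘ I.row := by
    funext k
    exact Matrix.mul_apply_eq_vecMul I N k
  rw [h2] at h1
  exact h1.of_comp

/-- With $N$ a right inverse at one point, $\det(I(y)N)\ne0$ is an open condition that forces full
rank. The same kind of neighbourhood underlies the affine charts. -/
theorem isOpen_linearIndependent {Z : SpaceWithFunctions}
    {I : Z.carrier → Matrix (Fin (d + 1)) (Fin r) ℂ}
    (hI : ∀ z k i, Z.IsRegularAt (fun y => I y k i) z) :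
    IsOpen {z | LinearIndependent ℂ (I z).row} := by
  refine isOpen_iff_mem_nhds.2 fun z hz => ?_
  obtain ⟨N, hN⟩ := exists_rightInverse_of_linearIndependent hz
  have hr : Z.IsRegularAt (fun y => (I y * N).det) z :=
    .det fun i j => .matrix_mul (hI z) (N := fun _ => N) (fun i j => Z.const (N i j) z) i j
  filter_upwards [IsRegularAt.eventually_ne hr (by simp [hN])] with y hy
  exact linearIndependent_of_det_ne_zero hy

/-- Independence of the $I_k$ is an open, scaling-invariant condition on $I$ alone. -/
theorem independentPairSolutions_eq_inter :
    ∃ U : Set (pairSpace d r).carrier, IsOpen U ∧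
      independentPairSolutions d r = pairSolutions d r ∩ U := by
  have hinv : ∀ {v v' : PairIndex d r → ℂ}, weightedSetoid (pairWeights d r) v v' →
      LinearIndependent ℂ (pairI v) → LinearIndependent ℂ (pairI v') := by
    rintro v v' ⟨t, ht⟩ h
    have hI : pairI v' = fun k => t • pairI v k := by
      funext k i
      simpa [pairWeights, pairI, Units.smul_def] using ht (Sum.inl (k, i))
    rw [hI]
    exact h.units_smul fun _ => t
  refine ⟨{q | ∃ (v : PairIndex d r → ℂ) (hv : v ≠ 0),
    weightedProjectiveSpace.mk (pairWeights d r) v hv = q ∧ LinearIndependent ℂ (pairI v)}, ?_, ?_⟩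
  · refine weightedProjectiveSpace.isOpen_of_isOpen
      (isOpen_linearIndependent (Z := affineSpace (PairIndex d r → ℂ)) (I := pairIMatrix)
        fun v k i => isRegularAt_apply _ v) fun v hv => ?_
    constructor
    · rintro ⟨v', hv', h, hL⟩
      exact hinv (weightedProjectiveSpace.mk_eq_mk.1 h) hL
    · intro h
      exact ⟨v, hv, rfl, h⟩
  · ext q
    constructor
    · rintro ⟨v, hv, h, hE, hL⟩
      exact ⟨⟨v, hv, h, hE⟩, v, hv, h, hL⟩
    · rintro ⟨⟨v, hv, h, hE⟩, v', hv', h', hL⟩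
      refine ⟨v, hv, h, hE, hinv (weightedProjectiveSpace.mk_eq_mk.1 (h'.trans h.symm)) hL⟩

end ADHM

/-! ### The symmetric part of $IJ$ and the action of $GL_r$ -/

namespace ADHM

open SpaceWithFunctions

variable {d r : ℕ}

/-- The pair `(I, J)` of matrices as a vector of coordinates. -/
def pairOf (I : Matrix (Fin (d + 1)) (Fin r) ℂ) (J : Matrix (Fin r) (Fin (d + 1)) ℂ) :
    PairIndex d r → ℂ :=
  Sum.elim (fun a => I a.1 a.2) (fun a => J a.2 a.1)

@[simp]
theorem pairIMatrix_pairOf (I : Matrix (Fin (d + 1)) (Fin r) ℂ)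
    (J : Matrix (Fin r) (Fin (d + 1)) ℂ) : pairIMatrix (pairOf I J) = I := rfl

@[simp]
theorem pairJMatrix_pairOf (I : Matrix (Fin (d + 1)) (Fin r) ℂ)
    (J : Matrix (Fin r) (Fin (d + 1)) ℂ) : pairJMatrix (pairOf I J) = J := rfl

theorem pairOf_matrix (v : PairIndex d r → ℂ) : pairOf (pairIMatrix v) (pairJMatrix v) = v := by
  funext i
  rcases i with i | i <;> rfl

theorem isRegularAt_pairOf {Z : SpaceWithFunctions} {z : Z.carrier}
    {I : Z.carrier → Matrix (Fin (d + 1)) (Fin r) ℂ}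
    {J : Z.carrier → Matrix (Fin r) (Fin (d + 1)) ℂ}
    (hI : ∀ k i, Z.IsRegularAt (fun y => I y k i) z)
    (hJ : ∀ i k, Z.IsRegularAt (fun y => J y i k) z) (j : PairIndex d r) :
    Z.IsRegularAt (fun y => pairOf (I y) (J y) j) z := by
  rcases j with j | j
  · exact hI _ _
  · exact hJ _ _

/-- Twice the symmetric part of `I J`, as a function of `J`. -/
def symPart (I : Matrix (Fin (d + 1)) (Fin r) ℂ) :
    Matrix (Fin r) (Fin (d + 1)) ℂ →ₗ[ℂ] (Sym2 (Fin (d + 1)) → ℂ) where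
  toFun J := Sym2.lift ⟨fun k m => (I * J) k m + (I * J) m k, fun _ _ => add_comm _ _⟩
  map_add' J J' := by
    funext s
    induction s with
    | h k m =>
      simp only [Sym2.lift_mk, Pi.add_apply, Matrix.mul_add, Matrix.add_apply]
      ring
  map_smul' t J := by
    funext s
    induction s with
    | h k m => simp [mul_add]

theorem mem_ker_symPart {I : Matrix (Fin (d + 1)) (Fin r) ℂ}
    {J : Matrix (Fin r) (Fin (d + 1)) ℂ} :
    J ∈ LinearMap.ker (symPart I) ↔ ∀ k m, (I * J) k m + (I * J) m k = 0 := by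
  rw [LinearMap.mem_ker, funext_iff]
  constructor
  · exact fun h k m => h s(k, m)
  · intro h s
    induction s with
    | h k m => exact h k m

theorem mem_independentPairs_iff {v : PairIndex d r → ℂ} :
    v ∈ independentPairs d r ↔ pairJMatrix v ∈ LinearMap.ker (symPart (pairIMatrix v)) ∧
      LinearIndependent ℂ (pairIMatrix v).row := by
  rw [mem_ker_symPart]
  exact and_congr pairEquations_iff_forall Iff.rfl

/-- Rank–nullity: the map is onto a space whose dimension is the number $\binom{d+2}2$ of unordered
pairs of indices. -/
theorem finrank_ker_symPart {I : Matrix (Fin (d + 1)) (Fin r) ℂ}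
    (hI : LinearIndependent ℂ I.row) :
    (d + 2).choose 2 + Module.finrank ℂ (LinearMap.ker (symPart I)) = (d + 1) * r := by
  obtain ⟨N, hN⟩ := exists_rightInverse_of_linearIndependent hI
  have hs : Function.Surjective (symPart I) := by
    intro f
    -- Since $IN=1$, this $J$ makes $IJ$ the symmetric matrix $f/2$, and symmetrizing doubles it.
    refine ⟨N * Matrix.of fun k m => f s(k, m) / 2, ?_⟩
    funext s
    induction s with
    | h k m =>
      simp only [symPart, LinearMap.coe_mk, AddHom.coe_mk, Sym2.lift_mk]
      rw [← Matrix.mul_assoc, hN, Matrix.one_mul, Matrix.of_apply, Matrix.of_apply,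
        Sym2.eq_swap (a := m), add_halves]
  have h := LinearMap.finrank_range_add_finrank_ker (symPart I)
  rw [LinearMap.range_eq_top.2 hs, finrank_top, Module.finrank_fintype_fun_eq_card, Sym2.card,
    Module.finrank_matrix] at h
  simpa [mul_comm] using h

/-- The isomorphism of row spans carrying $I_k$ to $I'_k$ extends to an automorphism of $\mathbb
C^r$; acting on rows, it is represented by the transposed matrix. -/
theorem exists_det_ne_zero_mul_eq {I I' : Matrix (Fin (d + 1)) (Fin r) ℂ}
    (hI : LinearIndependent ℂ I.row) (hI' : LinearIndependent ℂ I'.row) :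
    ∃ G : Matrix (Fin r) (Fin r) ℂ, G.det ≠ 0 ∧ I * G = I' := by
  obtain ⟨g, hg⟩ := Submodule.exists_linearEquiv_restrict_eq
    ((Module.Basis.span hI).equiv (Module.Basis.span hI') (Equiv.refl _))
  have hgI : ∀ k, g (I k) = I' k := by
    intro k
    have := hg (Module.Basis.span hI k)
    rw [Module.Basis.equiv_apply, Module.Basis.span_apply, Module.Basis.span_apply] at this
    exact this.symm
  refine ⟨(LinearMap.toMatrix' g.toLinearMap).transpose, ?_, ?_⟩
  · rw [Matrix.det_transpose, LinearMap.det_toMatrix']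
    exact (LinearEquiv.isUnit_det' g).ne_zero
  · ext k j
    rw [← hgI k]
    refine Eq.trans ?_ (congrFun (LinearMap.toMatrix'_mulVec g.toLinearMap (I k)) j)
    simp [Matrix.mul_apply, Matrix.mulVec, dotProduct, mul_comm]

/-! ### The twisted parametrization -/

/-- The equations depend only on the product, and $(IG)(G^{-1}K)=IK$. -/
theorem pairOf_mul_inv_mul_mem {I : Matrix (Fin (d + 1)) (Fin r) ℂ}
    (hI : LinearIndependent ℂ I.row) {G : Matrix (Fin r) (Fin r) ℂ} (hG : G.det ≠ 0)
    {K : Matrix (Fin r) (Fin (d + 1)) ℂ} (hK : K ∈ LinearMap.ker (symPart I)) :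
    pairOf (I * G) (G⁻¹ * K) ∈ independentPairs d r := by
  have hu : IsUnit G.det := isUnit_iff_ne_zero.2 hG
  have h : I * G * (G⁻¹ * K) = I * K := by
    rw [Matrix.mul_assoc, Matrix.mul_nonsing_inv_cancel_left _ _ hu]
  rw [mem_independentPairs_iff, pairIMatrix_pairOf, pairJMatrix_pairOf]
  constructor
  · rw [mem_ker_symPart, h]
    exact mem_ker_symPart.1 hK
  · obtain ⟨N, hN⟩ := exists_rightInverse_of_linearIndependent hI
    refine linearIndependent_of_det_ne_zero (N := G⁻¹ * N) ?_
    rw [Matrix.mul_assoc, Matrix.mul_nonsing_inv_cancel_left _ _ hu, hN, Matrix.det_one]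
    exact one_ne_zero

theorem irreducibleSpace_moduliGS (h : d < r) : IrreducibleSpace (moduliGS d r 1).carrier := by
  let I : Matrix (Fin (d + 1)) (Fin r) ℂ :=
    Matrix.of fun k => Pi.basisFun ℂ (Fin r) (Fin.castLE h k)
  have hI : LinearIndependent ℂ I.row :=
    (Pi.basisFun ℂ (Fin r)).linearIndependent.comp _ (Fin.castLE_injective h)
  -- The parametrization is $(u,G,K)\mapsto(u,[IG,G^{-1}K])$ on $\det G\ne0$, an open subset of an
  -- irreducible space. It is onto by transitivity of $GL_r$ on matrices of full rank.
  let V := (Fin (d + 1) ⊕ Fin (d + 1) → ℂ) × Matrix (Fin r) (Fin r) ℂ × LinearMap.ker (symPart I)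
  let D : Set (affineSpace V).carrier := {p : V | p.2.1.det ≠ 0}
  have hG : ∀ (p : (affineSpace V).carrier) i j,
      (affineSpace V).IsRegularAt (fun p : V => p.2.1 i j) p := fun p i j =>
    isRegularAt_linear (V := V) (Matrix.entryLinearMap ℂ ℂ i j ∘ₗ LinearMap.fst ℂ _ _ ∘ₗ
      LinearMap.snd ℂ _ _) p
  have hu : ∀ (p : (affineSpace V).carrier) i,
      (affineSpace V).IsRegularAt (fun p : V => p.1 i) p := fun p i =>
    isRegularAt_linear (V := V) ((LinearMap.proj i :
      (Fin (d + 1) ⊕ Fin (d + 1) → ℂ) →ₗ[ℂ] ℂ) ∘ₗ LinearMap.fst ℂ _ _) p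
  have hK : ∀ (p : (affineSpace V).carrier) i j,
      (affineSpace V).IsRegularAt (fun p : V => p.2.2.1 i j) p := fun p i j =>
    isRegularAt_linear (V := V) (Matrix.entryLinearMap ℂ ℂ i j ∘ₗ
      (LinearMap.ker (symPart I)).subtype ∘ₗ LinearMap.snd ℂ _ _ ∘ₗ LinearMap.snd ℂ _ _) p
  have hD : IsOpen D := isOpen_ne_zero fun p => .det (hG p)
  have hne : D.Nonempty := by
    refine ⟨((0, 1, 0) : V), ?_⟩
    change (1 : Matrix (Fin r) (Fin r) ℂ).det ≠ 0
    simp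
  have hirr : IsIrreducible D :=
    ⟨hne, (IrreducibleSpace.isIrreducible_univ _).isPreirreducible.open_subset hD
      (Set.subset_univ D)⟩
  have := Subtype.irreducibleSpace hirr
  let F : ((affineSpace V).restrict D).carrier → (moduliGS d r 1).carrier := fun p =>
    moduliGS.ofPair p.1.1 _ (pairOf_mul_inv_mul_mem hI p.2 p.1.2.2.2)
  have hF : Continuous F := continuous_iff_continuousAt.2 fun p => by
    have hv := isMorphismAt_subtype_val D p
    refine (moduliGS.isMorphismAt_of_lift (fun i => hv.2 _ (hu _ i)) (fun j => ?_)
      (Eventually.of_forall fun y => ⟨pairOf_mul_inv_mul_mem hI y.2 y.1.2.2.2, rfl⟩)).1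
    have hG' := fun i j => hv.2 _ (hG p.1 i j)
    refine isRegularAt_pairOf (fun k i => ?_) (fun i k => ?_) j
    · exact .matrix_mul (M := fun _ => I) (fun i j => SpaceWithFunctions.const _ (I i j) _) hG' k i
    · exact .matrix_mul (.matrix_inv hG' p.2) (fun i j => hv.2 _ (hK p.1 i j)) i k
  have hsurj : Function.Surjective F := by
    intro q
    obtain ⟨u, v, hv, rfl⟩ := moduliGS.exists_ofPair q
    obtain ⟨h1, h2⟩ := mem_independentPairs_iff.1 hv
    obtain ⟨G, hG, hIG⟩ := exists_det_ne_zero_mul_eq hI h2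
    have hK : G * pairJMatrix v ∈ LinearMap.ker (symPart I) := by
      rw [mem_ker_symPart] at h1 ⊢
      rwa [← Matrix.mul_assoc, hIG]
    refine ⟨⟨((u, G, ⟨_, hK⟩) : V), hG⟩, ?_⟩
    refine moduliGS.ofPair_eq_ofPair.2 ⟨rfl, ?_⟩
    have : pairOf (I * G) (G⁻¹ * (G * pairJMatrix v)) = v := by
      rw [hIG, Matrix.nonsing_inv_mul_cancel_left _ _ (isUnit_iff_ne_zero.2 hG), pairOf_matrix]
    change weightedSetoid _ (pairOf (I * G) (G⁻¹ * (G * pairJMatrix v))) v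
    rw [this]
  have himg : IsIrreducible (Set.univ : Set (moduliGS d r 1).carrier) :=
    Set.image_univ_of_surjective hsurj ▸
      (IrreducibleSpace.isIrreducible_univ D).image F hF.continuousOn
  exact { isPreirreducible_univ := himg.isPreirreducible, toNonempty := ⟨himg.nonempty.some⟩ }

/-! ### Local sections and affine charts of the moduli space -/

namespace moduliGS

/-- The representative of `[I, J]` for which the coordinate `a` is `1`. -/
noncomputable def localSection (a : PairIndex d r) (q : (moduliGS d r 1).carrier) :
    PairIndex d r → ℂ :=
  weightedProjectiveSpace.chartSection pairWeights_eq a (ij q)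

theorem localSection_mem {a : PairIndex d r} {q : (moduliGS d r 1).carrier} (hq : localSection a q a ≠ 0) :
    localSection a q ∈ independentPairs d r :=
  chartSection_mem_independentPairs (ij_mem q) hq

theorem isMorphismAt_localSection {a : PairIndex d r} {q : (moduliGS d r 1).carrier}
    (hq : localSection a q a ≠ 0) :
    IsMorphismAt (moduliGS d r 1) (affineSpace (PairIndex d r → ℂ)) (localSection a) q :=
  IsMorphismAt.comp (Y := pairSpace d r) (weightedProjectiveSpace.isMorphismAt_chartSection hq)
    (isMorphismAt_ij q)

theorem isRegularAt_localSection {a : PairIndex d r} {q : (moduliGS d r 1).carrier}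
    (hq : localSection a q a ≠ 0) (i : PairIndex d r) :
    (moduliGS d r 1).IsRegularAt (fun q => localSection a q i) q :=
  (isMorphismAt_localSection hq).2 _ (isRegularAt_apply i _)

theorem ofPair_localSection {a : PairIndex d r} {q : (moduliGS d r 1).carrier}
    (hq : localSection a q a ≠ 0) : ofPair (ab q) (localSection a q) (localSection_mem hq) = q := by
  obtain ⟨u, v, hv, rfl⟩ := exists_ofPair q
  refine ofPair_eq_ofPair.2 ⟨ab_ofPair, ?_⟩
  obtain ⟨h1, h2⟩ := weightedProjectiveSpace.mk_chartSection hq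
  exact weightedProjectiveSpace.mk_eq_mk.1 (h2.trans ij_ofPair)

theorem localSection_ofPair_self_ne {a : PairIndex d r} {u : Fin (d + 1) ⊕ Fin (d + 1) → ℂ}
    {v : PairIndex d r → ℂ} {hv : v ∈ independentPairs d r} :
    localSection a (ofPair u v hv) a ≠ 0 ↔ v a ≠ 0 := by
  rw [localSection, ij_ofPair]
  exact weightedProjectiveSpace.chartSection_mk_self_ne

theorem localSection_ofPair_of_eq_one {a : PairIndex d r} {u : Fin (d + 1) ⊕ Fin (d + 1) → ℂ}
    {v : PairIndex d r → ℂ} {hv : v ∈ independentPairs d r} (h : v a = 1) :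
    localSection a (ofPair u v hv) = v := by
  rw [localSection, ij_ofPair]
  exact weightedProjectiveSpace.chartSection_mk_of_eq_one h

end moduliGS

section Chart

variable {I h : Matrix (Fin (d + 1)) (Fin r) ℂ} {N : Matrix (Fin r) (Fin (d + 1)) ℂ}

theorem mul_one_add_mul (hN : I * N = 1) : I * (1 + N * h) = I + h := by
  rw [Matrix.mul_add, Matrix.mul_one, ← Matrix.mul_assoc, hN, Matrix.one_mul]

/-- Sylvester's identity $\det(1+Nh)=\det(1+hN)$. It makes $1+Nh$ invertible exactly where the rank
condition $\det((I+h)N)\ne0$ holds. -/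
theorem det_one_add_mul_eq (hN : I * N = 1) : (1 + N * h).det = ((I + h) * N).det := by
  rw [Matrix.det_one_add_mul_comm, Matrix.add_mul, hN]

/-- Let $(I',J')$ be the representative with $I'_{0i}=1$, $I$ its value at $q$, $h=I'-I$ and
$G=1+Nh$. As $IG=I'$, multiplication by $G$ carries the kernel for $I'$ to that for $I$. The chart
is $(u,h,GJ')$, with inverse $(u,h,K)\mapsto(u,[I+h,G^{-1}K])$. -/
theorem isLocallyAffine_chart (q : (moduliGS d r 1).carrier) {i : Fin r}
    (hq : moduliGS.localSection (Sum.inl (0, i)) q (Sum.inl (0, i)) ≠ 0) :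
    ∃ U : Set (moduliGS d r 1).carrier, IsOpen U ∧ q ∈ U ∧
      ∃ D : Set (affineSpace ((Fin (d + 1) ⊕ Fin (d + 1) → ℂ) ×
        LinearMap.ker (Matrix.entryLinearMap (m := Fin (d + 1)) ℂ ℂ 0 i) ×
        LinearMap.ker (symPart (pairIMatrix (moduliGS.localSection (Sum.inl (0, i)) q))))).carrier,
        IsOpen D ∧ Nonempty (Iso ((moduliGS d r 1).restrict U) ((affineSpace _).restrict D)) := by
  let a : PairIndex d r := Sum.inl (0, i)
  let σ : (moduliGS d r 1).carrier → PairIndex d r → ℂ := moduliGS.localSection a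
  let I : Matrix (Fin (d + 1)) (Fin r) ℂ := pairIMatrix (σ q)
  have hI : LinearIndependent ℂ I.row := (mem_independentPairs_iff.1 (moduliGS.localSection_mem hq)).2
  obtain ⟨N, hN⟩ := exists_rightInverse_of_linearIndependent hI
  have hσ1 : ∀ q', σ q' a ≠ 0 → pairIMatrix (σ q') 0 i = 1 := fun q' hq' =>
    weightedProjectiveSpace.chartSection_self hq'
  -- The differences of two normalized matrices: the entry $(0,i)$ stays equal to $1$.
  let H := LinearMap.ker (Matrix.entryLinearMap (m := Fin (d + 1)) (n := Fin r) ℂ ℂ 0 i)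
  let V := (Fin (d + 1) ⊕ Fin (d + 1) → ℂ) × H × LinearMap.ker (symPart I)
  let U : Set (moduliGS d r 1).carrier := {q | σ q a ≠ 0 ∧ (pairIMatrix (σ q) * N).det ≠ 0}
  let D : Set (affineSpace V).carrier := {p : V | ((I + p.2.1.1) * N).det ≠ 0}
  have hσ : ∀ q', σ q' a ≠ 0 → ∀ j, (moduliGS d r 1).IsRegularAt (fun q => σ q j) q' :=
    fun q' hq' j => moduliGS.isRegularAt_localSection hq' j
  have hU : IsOpen U := by
    refine isOpen_iff_mem_nhds.2 fun q' hq' => ?_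
    have h1 : (moduliGS d r 1).IsRegularAt (fun q => (pairIMatrix (σ q) * N).det) q' :=
      .det fun k m => .matrix_mul (fun k i => hσ q' hq'.1 (Sum.inl (k, i)))
        (N := fun _ => N) (fun i j => SpaceWithFunctions.const _ (N i j) _) k m
    filter_upwards [IsRegularAt.eventually_ne (hσ q' hq'.1 a) hq'.1,
      IsRegularAt.eventually_ne h1 hq'.2] with y h2 h3 using ⟨h2, h3⟩
  have hqU : q ∈ U := by
    refine ⟨hq, ?_⟩
    change (I * N).det ≠ 0
    simp [hN]
  have ru : ∀ (p : (affineSpace V).carrier) j,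
      (affineSpace V).IsRegularAt (fun p : V => p.1 j) p := fun p j =>
    isRegularAt_linear (V := V) ((LinearMap.proj j :
      (Fin (d + 1) ⊕ Fin (d + 1) → ℂ) →ₗ[ℂ] ℂ) ∘ₗ LinearMap.fst ℂ _ _) p
  have rh : ∀ (p : (affineSpace V).carrier) k j,
      (affineSpace V).IsRegularAt (fun p : V => p.2.1.1 k j) p := fun p k j =>
    isRegularAt_linear (V := V) (Matrix.entryLinearMap ℂ ℂ k j ∘ₗ H.subtype ∘ₗ
      LinearMap.fst ℂ _ _ ∘ₗ LinearMap.snd ℂ _ _) p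
  have rK : ∀ (p : (affineSpace V).carrier) k j,
      (affineSpace V).IsRegularAt (fun p : V => p.2.2.1 k j) p := fun p k j =>
    isRegularAt_linear (V := V) (Matrix.entryLinearMap ℂ ℂ k j ∘ₗ
      (LinearMap.ker (symPart I)).subtype ∘ₗ LinearMap.snd ℂ _ _ ∘ₗ LinearMap.snd ℂ _ _) p
  have rI : ∀ (p : (affineSpace V).carrier) k j,
      (affineSpace V).IsRegularAt (fun p : V => (I + p.2.1.1) k j) p := fun p k j =>
    SpaceWithFunctions.add _ (SpaceWithFunctions.const _ (I k j) p) (rh p k j)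
  have hD : IsOpen D := isOpen_ne_zero fun p => .det fun k m => .matrix_mul (rI p)
    (N := fun _ => N) (fun i j => SpaceWithFunctions.const _ (N i j) _) k m
  have hG : ∀ p : ((affineSpace V).restrict D).carrier, (1 + N * p.1.2.1.1).det ≠ 0 := by
    intro p
    rw [det_one_add_mul_eq hN]
    exact p.2
  let w : ((affineSpace V).restrict D).carrier → PairIndex d r → ℂ := fun p =>
    pairOf (I + p.1.2.1.1) ((1 + N * p.1.2.1.1)⁻¹ * p.1.2.2.1)
  have hw : ∀ p, w p ∈ independentPairs d r := by
    intro p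
    have := pairOf_mul_inv_mul_mem hI (hG p) p.1.2.2.2
    rwa [mul_one_add_mul hN] at this
  have hwa : ∀ p, w p a = 1 := by
    intro p
    have h1 : I 0 i = 1 := hσ1 q hq
    have h2 : p.1.2.1.1 0 i = 0 := p.1.2.1.2
    change I 0 i + p.1.2.1.1 0 i = 1
    rw [h1, h2, add_zero]
  have hσw : ∀ p u, σ (moduliGS.ofPair u (w p) (hw p)) = w p := fun p u =>
    moduliGS.localSection_ofPair_of_eq_one (hwa p)
  let f : ((moduliGS d r 1).restrict U).carrier → ((affineSpace V).restrict D).carrier := fun q =>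
    ⟨((moduliGS.ab q.1, ⟨pairIMatrix (σ q.1) - I, by
        have h1 : I 0 i = 1 := hσ1 _ hq
        change pairIMatrix (σ q.1) 0 i - I 0 i = 0
        rw [hσ1 _ q.2.1, h1, sub_self]⟩,
      ⟨(1 + N * (pairIMatrix (σ q.1) - I)) * pairJMatrix (σ q.1), by
        rw [mem_ker_symPart, ← Matrix.mul_assoc, mul_one_add_mul hN, add_sub_cancel]
        exact mem_ker_symPart.1 (mem_independentPairs_iff.1 (moduliGS.localSection_mem q.2.1)).1⟩) : V),
      by
        change ((I + (pairIMatrix (σ q.1) - I)) * N).det ≠ 0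
        rw [add_sub_cancel]
        exact q.2.2⟩
  let g : ((affineSpace V).restrict D).carrier → ((moduliGS d r 1).restrict U).carrier := fun p =>
    ⟨moduliGS.ofPair p.1.1 (w p) (hw p), by
      change σ _ a ≠ 0 ∧ (pairIMatrix (σ _) * N).det ≠ 0
      rw [hσw]
      exact ⟨by rw [hwa]; exact one_ne_zero, p.2⟩⟩
  refine ⟨U, hU, hqU, D, hD, ⟨Iso.ofInverse f g ?_ ?_ ?_ ?_⟩⟩
  · intro q'
    have hdet := hG (f q')
    have hwf : w (f q') = σ q'.1 := by
      change pairOf (I + (pairIMatrix (σ q'.1) - I)) ((1 + N * (pairIMatrix (σ q'.1) - I))⁻¹ *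
        ((1 + N * (pairIMatrix (σ q'.1) - I)) * pairJMatrix (σ q'.1))) = _
      rw [Matrix.nonsing_inv_mul_cancel_left _ _ (isUnit_iff_ne_zero.2 hdet), add_sub_cancel,
        pairOf_matrix]
    refine Subtype.ext (Eq.trans ?_ (moduliGS.ofPair_localSection q'.2.1))
    refine (moduliGS.ofPair_eq_ofPair (hv := hw (f q'))).2 ⟨rfl, ?_⟩
    rw [hwf]
  · intro p
    have h1 : σ (g p).1 = w p := hσw p _
    have h2 : pairIMatrix (σ (g p).1) - I = p.1.2.1.1 := by
      rw [h1]
      exact add_sub_cancel_left _ _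
    refine Subtype.ext (Prod.ext (moduliGS.ab_ofPair (hv := hw p)) (Prod.ext (Subtype.ext h2) (Subtype.ext ?_)))
    change (1 + N * (pairIMatrix (σ (g p).1) - I)) * pairJMatrix (σ (g p).1) = p.1.2.2.1
    rw [h2, h1]
    exact Matrix.mul_nonsing_inv_cancel_left _ _ (isUnit_iff_ne_zero.2 (hG p))
  · intro q'
    have hv := isMorphismAt_subtype_val U q'
    have rσ := fun j => hv.2 _ (hσ q'.1 q'.2.1 j)
    have rh : ∀ k j, ((moduliGS d r 1).restrict U).IsRegularAt
        (fun q => (pairIMatrix (σ q.1) - I) k j) q' := fun k j =>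
      IsRegularAt.sub (rσ (Sum.inl (k, j))) (SpaceWithFunctions.const _ (I k j) _)
    refine IsMorphismAt.codRestrict (X := affineSpace V) (isMorphismAt_affineSpace_prod
      ((moduliGS.isMorphismAt_ab _).comp hv) (isMorphismAt_affineSpace_prod
        (isMorphismAt_affineSpace_submodule (isMorphismAt_matrix rh))
        (isMorphismAt_affineSpace_submodule (isMorphismAt_matrix fun k j => ?_))))
    refine .matrix_mul (fun k j => ?_) (fun k j => rσ (Sum.inr (j, k))) k j
    exact SpaceWithFunctions.add _
      (SpaceWithFunctions.const _ ((1 : Matrix (Fin r) (Fin r) ℂ) k j) _)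
      (.matrix_mul (M := fun _ => N) (fun i j => SpaceWithFunctions.const _ (N i j) _) rh k j)
  · intro p
    have hv := isMorphismAt_subtype_val D p
    refine IsMorphismAt.codRestrict (moduliGS.isMorphismAt_of_lift (fun j => hv.2 _ (ru p.1 j))
      (fun j => ?_) (Eventually.of_forall fun y => ⟨hw y, rfl⟩))
    refine isRegularAt_pairOf (fun k j => hv.2 _ (rI p.1 k j)) (fun k j => ?_) j
    refine .matrix_mul (.matrix_inv (fun k j => ?_) (hG p)) (fun k j => hv.2 _ (rK p.1 k j)) k j
    exact SpaceWithFunctions.add _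
      (SpaceWithFunctions.const _ ((1 : Matrix (Fin r) (Fin r) ℂ) k j) _)
      (.matrix_mul (M := fun _ => N) (fun i j => SpaceWithFunctions.const _ (N i j) _)
        (fun k j => hv.2 _ (rh p.1 k j)) k j)

end Chart

theorem isLocallyAffine_moduliGS :
    (moduliGS d r 1).IsLocallyAffine
      (2 * (d + 1) + 2 * ((d + 1) * r) - 1 - (d + 2).choose 2) := by
  intro q
  obtain ⟨i, hi⟩ : ∃ i, moduliGS.localSection (Sum.inl (0, i)) q (Sum.inl (0, i)) ≠ 0 := by
    obtain ⟨u, v, hv, rfl⟩ := moduliGS.exists_ofPair q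
    obtain ⟨i, hi⟩ := Function.ne_iff.1 (hv.2.ne_zero 0)
    exact ⟨i, moduliGS.localSection_ofPair_self_ne.2 hi⟩
  obtain ⟨U, hU, hqU, D, hD, hΦ⟩ := isLocallyAffine_chart q hi
  refine ⟨U, hU, hqU, _, inferInstance, inferInstance, inferInstance, ?_, D, hD, hΦ⟩
  have h1 := finrank_ker_symPart
    (mem_independentPairs_iff.1 (moduliGS.localSection_mem hi)).2
  have hs : Function.Surjective
      (Matrix.entryLinearMap (m := Fin (d + 1)) (n := Fin r) ℂ ℂ 0 i) := fun t =>
    ⟨Matrix.of fun _ _ => t, rfl⟩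
  have h2 := LinearMap.finrank_range_add_finrank_ker
    (Matrix.entryLinearMap (m := Fin (d + 1)) (n := Fin r) ℂ ℂ 0 i)
  rw [LinearMap.range_eq_top.2 hs, finrank_top, Module.finrank_self, Module.finrank_matrix] at h2
  simp only [Fintype.card_fin, Module.finrank_self, mul_one] at h2
  rw [Module.finrank_prod, Module.finrank_prod, Module.finrank_fintype_fun_eq_card,
    Fintype.card_sum, Fintype.card_fin]
  omega

end ADHM

/-! ### The projective embedding -/

namespace ADHM

open SpaceWithFunctions

variable {d r : ℕ}

/-- The index set of the homogeneous coordinates `I_a`, `I_a u_k`, `I_a I_b J_c`. -/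
abbrev SegreIndex (d r : ℕ) : Type :=
  (Fin (d + 1) × Fin r) ⊕ ((Fin (d + 1) × Fin r) × (Fin (d + 1) ⊕ Fin (d + 1))) ⊕
    ((Fin (d + 1) × Fin r) × (Fin (d + 1) × Fin r) × (Fin (d + 1) × Fin r))

/-- The homogeneous coordinates `I_a`, `I_a u_k`, `I_a I_b J_c`. -/
def segre (u : Fin (d + 1) ⊕ Fin (d + 1) → ℂ) (v : PairIndex d r → ℂ) : SegreIndex d r → ℂ
  | Sum.inl a => v (Sum.inl a)
  | Sum.inr (Sum.inl (a, k)) => v (Sum.inl a) * u k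
  | Sum.inr (Sum.inr (a, b, c)) => v (Sum.inl a) * v (Sum.inl b) * v (Sum.inr c)

/-- The coordinates `u` recovered from homogeneous coordinates with `I_a = 1`. -/
def unsegreFst (a : Fin (d + 1) × Fin r) (y : SegreIndex d r → ℂ) :
    Fin (d + 1) ⊕ Fin (d + 1) → ℂ :=
  fun k => y (Sum.inr (Sum.inl (a, k)))

/-- The coordinates `v` recovered from homogeneous coordinates with `I_a = 1`. -/
def unsegreSnd (a : Fin (d + 1) × Fin r) (y : SegreIndex d r → ℂ) : PairIndex d r → ℂ :=
  Sum.elim (fun b => y (Sum.inl b)) (fun c => y (Sum.inr (Sum.inr (a, a, c))))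

theorem unsegreFst_segre {a : Fin (d + 1) × Fin r} {u : Fin (d + 1) ⊕ Fin (d + 1) → ℂ}
    {v : PairIndex d r → ℂ} (h : v (Sum.inl a) = 1) : unsegreFst a (segre u v) = u := by
  funext k
  simp [unsegreFst, segre, h]

theorem unsegreSnd_segre {a : Fin (d + 1) × Fin r} {u : Fin (d + 1) ⊕ Fin (d + 1) → ℂ}
    {v : PairIndex d r → ℂ} (h : v (Sum.inl a) = 1) : unsegreSnd a (segre u v) = v := by
  funext k
  rcases k with k | k <;> simp [unsegreSnd, segre, h]

/-- The equations of the closure of the image of the Segre embedding. -/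
def SegreEquations (y : SegreIndex d r → ℂ) : Prop :=
  (∀ a b k, y (Sum.inr (Sum.inl (a, k))) * y (Sum.inl b) =
    y (Sum.inr (Sum.inl (b, k))) * y (Sum.inl a)) ∧
  (∀ a e b c, y (Sum.inr (Sum.inr (a, b, c))) * y (Sum.inl e) =
    y (Sum.inr (Sum.inr (e, b, c))) * y (Sum.inl a)) ∧
  (∀ a b c, y (Sum.inr (Sum.inr (a, b, c))) = y (Sum.inr (Sum.inr (b, a, c)))) ∧
  (∀ a k m, ∑ i, y (Sum.inr (Sum.inr (a, (k, i), (m, i)))) +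
    ∑ i, y (Sum.inr (Sum.inr (a, (m, i), (k, i)))) = 0)

/-- The vectors `I_k` of homogeneous coordinates. -/
def segreI (y : SegreIndex d r → ℂ) : Matrix (Fin (d + 1)) (Fin r) ℂ :=
  Matrix.of fun k i => y (Sum.inl (k, i))

theorem segreEquations_segre (u : Fin (d + 1) ⊕ Fin (d + 1) → ℂ) {v : PairIndex d r → ℂ}
    (hv : PairEquations v) : SegreEquations (segre u v) := by
  refine ⟨fun a b k => ?_, fun a e b c => ?_, fun a b c => ?_, fun a k m => ?_⟩
  · simp only [segre]
    ring
  · simp only [segre]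
    ring
  · simp only [segre]
    ring
  · have h := pairEquations_iff_forall.1 hv k m
    simp only [dotProduct, pairI, pairJ] at h
    simp only [segre, mul_assoc, ← Finset.mul_sum]
    rw [← mul_add, h, mul_zero]

/-- With $y_a=1$ the exchange relations give $y_{b,k}=y_by_{a,k}$ and, with the symmetry in the
first two indices, $y_{b,c,e}=y_by_cy_{a,a,e}$. -/
theorem segre_unsegre {a : Fin (d + 1) × Fin r} {y : SegreIndex d r → ℂ} (hy : SegreEquations y)
    (h : y (Sum.inl a) = 1) : segre (unsegreFst a y) (unsegreSnd a y) = y := by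
  obtain ⟨h1, h2, h3, -⟩ := hy
  funext i
  rcases i with b | ⟨b, k⟩ | ⟨b, c, e⟩
  · rfl
  · simp only [segre, unsegreFst, unsegreSnd, Sum.elim_inl]
    have := h1 b a k
    rw [h, mul_one] at this
    rw [this, mul_comm]
  · simp only [segre, unsegreSnd, Sum.elim_inl, Sum.elim_inr]
    have e1 := h2 b a c e
    have e2 := h2 c a a e
    rw [h, mul_one] at e1 e2
    rw [e1, h3 a c e, e2]
    ring

theorem unsegreSnd_mem {a : Fin (d + 1) × Fin r} {y : SegreIndex d r → ℂ} (hy : SegreEquations y)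
    (hI : LinearIndependent ℂ (segreI y).row) (h : y (Sum.inl a) = 1) :
    unsegreSnd a y ∈ independentPairs d r := by
  refine ⟨pairEquations_iff_forall.2 fun k m => ?_, hI⟩
  obtain ⟨-, h2, h3, h4⟩ := hy
  have e : ∀ b c, y (Sum.inr (Sum.inr (a, b, c))) =
      y (Sum.inl b) * y (Sum.inr (Sum.inr (a, a, c))) := by
    intro b c
    have e2 := h2 b a a c
    rw [h, mul_one] at e2
    rw [h3 a b c, e2, mul_comm]
  have := h4 a k m
  rw [Finset.sum_congr rfl fun i _ => e (k, i) (m, i),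
    Finset.sum_congr rfl fun i _ => e (m, i) (k, i)] at this
  exact this

section Embedding

variable {N : ℕ} (e : SegreIndex d r ≃ Fin (N + 1))

/-- The weights of the projective space. -/
abbrev unitWeights (N : ℕ) : Fin (N + 1) → ℤ := fun _ => 1

theorem segre_comp_ne_zero (u : Fin (d + 1) ⊕ Fin (d + 1) → ℂ) {v : PairIndex d r → ℂ}
    (hv : v ∈ independentPairs d r) : segre u v ∘ e.symm ≠ 0 := by
  intro h
  refine hv.2.ne_zero 0 (funext fun i => ?_)
  have h0 : v (Sum.inl (0, i)) = 0 := by simpa [segre] using congrFun h (e (Sum.inl (0, i)))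
  exact h0

/-- The three kinds of coordinates have weights $1$, $1+0$ and $1+1-1$. -/
theorem weightedSetoid_segre {u : Fin (d + 1) ⊕ Fin (d + 1) → ℂ} {v v' : PairIndex d r → ℂ}
    (h : weightedSetoid (pairWeights d r) v v') :
    weightedSetoid (unitWeights N) (segre u v ∘ e.symm) (segre u v' ∘ e.symm) := by
  obtain ⟨t, ht⟩ := h
  have h1 : ∀ a, v' (Sum.inl a) = t * v (Sum.inl a) := fun a => by
    simpa [pairWeights] using ht (Sum.inl a)
  have h2 : ∀ a, v' (Sum.inr a) = (t : ℂ)⁻¹ * v (Sum.inr a) := fun a => by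
    simpa [pairWeights] using ht (Sum.inr a)
  refine ⟨t, fun i => ?_⟩
  have ht0 := t.ne_zero
  simp only [Function.comp_apply, zpow_one]
  rcases e.symm i with b | ⟨b, k⟩ | ⟨b, c, f⟩ <;> simp only [segre, h1, h2] <;> field_simp

/-- The Segre embedding of the moduli space in a projective space. -/
def segreEmbedding : (moduliGS d r 1).carrier → (weightedProjectiveSpace (unitWeights N)).carrier :=
  Quotient.lift (fun X => weightedProjectiveSpace.mk (unitWeights N) (segre (abCoords X.1) (ijCoords X.1) ∘ e.symm)
    (segre_comp_ne_zero e _ ((mem_globallyStableSolutions_iff _).1 X.2))) <| by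
    rintro ⟨X, hX⟩ ⟨X', hX'⟩ h
    obtain ⟨h1, h2⟩ := (gaugeSetoid_iff X X').1 h
    refine weightedProjectiveSpace.mk_eq_mk.2 ?_
    simp only [← h1]
    exact weightedSetoid_segre e h2

theorem segreEmbedding_ofPair {u : Fin (d + 1) ⊕ Fin (d + 1) → ℂ} {v : PairIndex d r → ℂ}
    {hv : v ∈ independentPairs d r} : segreEmbedding e (moduliGS.ofPair u v hv) =
      weightedProjectiveSpace.mk (unitWeights N) (segre u v ∘ e.symm) (segre_comp_ne_zero e u hv) := by
  change weightedProjectiveSpace.mk (unitWeights N) (segre (abCoords (ofCoords d r (u, v)))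
    (ijCoords (ofCoords d r (u, v))) ∘ e.symm) _ = _
  congr 1
  rw [abCoords_ofCoords, ijCoords_ofCoords]

theorem isMorphismAt_segreEmbedding (q : (moduliGS d r 1).carrier) :
    IsMorphismAt (moduliGS d r 1) (weightedProjectiveSpace (unitWeights N)) (segreEmbedding e) q := by
  refine moduliGS.isMorphismAt_of_comp (fun X => isMorphismAt_weightedProjectiveSpace_of_lift
    (isMorphismAt_pi fun i => ?_) (Eventually.of_forall fun _ => ⟨_, rfl⟩)) q
  have ha := fun k => moduliGS.isRegularAt_subtype_abCoords k X
  have hi := fun k => moduliGS.isRegularAt_subtype_ijCoords k X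
  simp only [Function.comp_apply]
  rcases e.symm i with b | ⟨b, k⟩ | ⟨b, c, f⟩
  · exact hi _
  · exact SpaceWithFunctions.mul _ (hi _) (ha _)
  · exact SpaceWithFunctions.mul _ (SpaceWithFunctions.mul _ (hi _) (hi _)) (hi _)

theorem one_weights (N : ℕ) (i : Fin (N + 1)) :
    unitWeights N i = 1 ∨ unitWeights N i = -1 :=
  Or.inl rfl

/-- The homogeneous coordinates normalized by `I_a = 1`. -/
noncomputable def segreChart (a : Fin (d + 1) × Fin r) (p : (weightedProjectiveSpace (unitWeights N)).carrier) :
    SegreIndex d r → ℂ :=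
  weightedProjectiveSpace.chartSection (one_weights N) (e (Sum.inl a)) p ∘ e

theorem segreChart_apply (a : Fin (d + 1) × Fin r) (p : (weightedProjectiveSpace (unitWeights N)).carrier)
    (i : SegreIndex d r) : segreChart e a p i =
      weightedProjectiveSpace.chartSection (one_weights N) (e (Sum.inl a)) p (e i) := rfl

theorem segreChart_mk_ne {a : Fin (d + 1) × Fin r} {z : Fin (N + 1) → ℂ} {hz : z ≠ 0} :
    segreChart e a (weightedProjectiveSpace.mk (unitWeights N) z hz) (Sum.inl a) ≠ 0 ↔ z (e (Sum.inl a)) ≠ 0 :=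
  weightedProjectiveSpace.chartSection_mk_self_ne (hw := one_weights N) (a := e (Sum.inl a))

/-- Since $I_0\ne0$, the charts at the coordinates of $I$ already cover the image. -/
theorem exists_segreChart_ne (q : (moduliGS d r 1).carrier) :
    ∃ a, segreChart e a (segreEmbedding e q) (Sum.inl a) ≠ 0 := by
  obtain ⟨u, v, hv, rfl⟩ := moduliGS.exists_ofPair q
  obtain ⟨i, hi⟩ := Function.ne_iff.1 (hv.2.ne_zero 0)
  refine ⟨(0, i), ?_⟩
  rw [segreEmbedding_ofPair]
  refine (segreChart_mk_ne e).2 ?_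
  simpa [segre] using! hi

/-- On $I_a\ne0$ the normalized homogeneous coordinates are those of the representative with
$I_a=1$, from which $u$ and $v$ are read off. This gives injectivity and regularity of the inverse.
-/
theorem eq_ofPair_segreChart {a : Fin (d + 1) × Fin r} {q : (moduliGS d r 1).carrier}
    (h : segreChart e a (segreEmbedding e q) (Sum.inl a) ≠ 0) :
    ∃ hy : unsegreSnd a (segreChart e a (segreEmbedding e q)) ∈ independentPairs d r,
      q = moduliGS.ofPair (unsegreFst a (segreChart e a (segreEmbedding e q)))
        (unsegreSnd a (segreChart e a (segreEmbedding e q))) hy := by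
  have hq : moduliGS.localSection (Sum.inl a) q (Sum.inl a) ≠ 0 := by
    obtain ⟨u, v, hv, rfl⟩ := moduliGS.exists_ofPair q
    rw [segreEmbedding_ofPair] at h
    have := (segreChart_mk_ne e).1 h
    rw [moduliGS.localSection_ofPair_self_ne]
    simpa [segre] using this
  have h1 : moduliGS.localSection (Sum.inl a) q (Sum.inl a) = 1 :=
    weightedProjectiveSpace.chartSection_self hq
  have h2 : segreChart e a (segreEmbedding e q) =
      segre (moduliGS.ab q) (moduliGS.localSection (Sum.inl a) q) := by
    conv_lhs => rw [← moduliGS.ofPair_localSection hq, segreEmbedding_ofPair]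
    funext i
    rw [segreChart_apply]
    have h3 := weightedProjectiveSpace.chartSection_mk_of_eq_one (hw := one_weights N)
      (a := e (Sum.inl a)) (v := segre (moduliGS.ab q) (moduliGS.localSection (Sum.inl a) q) ∘ e.symm)
      (hv := segre_comp_ne_zero e _ (moduliGS.localSection_mem hq)) (by simpa [segre] using h1)
    refine (congrFun h3 (e i)).trans ?_
    simp
  rw [h2, unsegreFst_segre h1, unsegreSnd_segre h1]
  exact ⟨moduliGS.localSection_mem hq, (moduliGS.ofPair_localSection hq).symm⟩

theorem segreEmbedding_injective : Function.Injective (segreEmbedding (d := d) (r := r) e) := by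
  intro q q' h
  obtain ⟨a, ha⟩ := exists_segreChart_ne e q
  obtain ⟨h1, h2⟩ := eq_ofPair_segreChart e ha
  obtain ⟨h3, h4⟩ := eq_ofPair_segreChart e (h ▸ ha)
  rw [h2, h4]
  simp only [h]

/-- The moduli space is isomorphic to the image of the Segre embedding. -/
noncomputable def moduliGSSegreIso :
    Iso (moduliGS d r 1) ((weightedProjectiveSpace (unitWeights N)).restrict (Set.range (segreEmbedding e))) :=
  Iso.ofInverse (fun q => ⟨segreEmbedding e q, q, rfl⟩) (fun p => p.2.choose)
    (fun q => segreEmbedding_injective e (Exists.choose_spec (⟨q, rfl⟩ :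
      ∃ q', segreEmbedding e q' = segreEmbedding e q)))
    (fun p => Subtype.ext p.2.choose_spec)
    (fun q => IsMorphismAt.codRestrict (isMorphismAt_segreEmbedding e q))
    (fun p => by
      -- Near $p$ the chosen preimage is the one read off from the coordinates normalized at $a$.
      obtain ⟨a, ha⟩ := exists_segreChart_ne e p.2.choose
      rw [p.2.choose_spec] at ha
      have hv := isMorphismAt_subtype_val (X := weightedProjectiveSpace (unitWeights N))
        (Set.range (segreEmbedding e)) p
      have hc : IsMorphismAt ((weightedProjectiveSpace (unitWeights N)).restrict (Set.range (segreEmbedding e)))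
          (affineSpace (Fin (N + 1) → ℂ))
          (fun p => weightedProjectiveSpace.chartSection (one_weights N) (e (Sum.inl a)) p.1) p :=
        IsMorphismAt.comp (Y := weightedProjectiveSpace (unitWeights N))
          (weightedProjectiveSpace.isMorphismAt_chartSection ha) hv
      have hr := fun i : SegreIndex d r => hc.2 _ (isRegularAt_apply (e i) _)
      refine moduliGS.isMorphismAt_of_lift 
        (Z := (weightedProjectiveSpace (unitWeights N)).restrict (Set.range (segreEmbedding e)))
        (u := fun p => unsegreFst a (segreChart e a p.1))
        (v := fun p => unsegreSnd a (segreChart e a p.1)) (fun k => hr _) (fun k => ?_) ?_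
      · rcases k with k | k
        · exact hr _
        · exact hr _
      · filter_upwards [hv.1.preimage_mem_nhds
          ((weightedProjectiveSpace.isOpen_chartSection_ne (hw := one_weights N)
            (a := e (Sum.inl a))).mem_nhds ha)] with y hy
        have h := eq_ofPair_segreChart e (a := a) (q := y.2.choose) (by
          rw [y.2.choose_spec]
          exact hy)
        simp only [y.2.choose_spec] at h
        exact h)

theorem isClosed_eq_of_isRegularAt {X : SpaceWithFunctions} {f g : X.carrier → ℂ}
    (hf : ∀ x, X.IsRegularAt f x) (hg : ∀ x, X.IsRegularAt g x) : IsClosed {x | f x = g x} := by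
  have := isClosed_eq_zero fun x => IsRegularAt.sub (hf x) (hg x)
  simpa only [sub_eq_zero] using this

theorem isClosed_setOf_forall {A ι : Type*} [TopologicalSpace A] {P : ι → A → Prop}
    (h : ∀ i, IsClosed {x | P i x}) : IsClosed {x | ∀ i, P i x} := by
  convert isClosed_iInter h
  ext x
  simp

theorem isClosed_segreEquations :
    IsClosed (X := (affineSpace (Fin (N + 1) → ℂ)).carrier)
      {z : Fin (N + 1) → ℂ | SegreEquations (z ∘ e)} := by
  have hr : ∀ i z, (affineSpace (Fin (N + 1) → ℂ)).IsRegularAt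
      (fun z : Fin (N + 1) → ℂ => (z ∘ e) i) z := fun i z => isRegularAt_apply (e i) z
  refine .inter (isClosed_setOf_forall fun a => isClosed_setOf_forall fun b =>
    isClosed_setOf_forall fun k => ?_) (.inter (isClosed_setOf_forall fun a =>
    isClosed_setOf_forall fun b => isClosed_setOf_forall fun c => isClosed_setOf_forall fun k => ?_)
    (.inter (isClosed_setOf_forall fun a => isClosed_setOf_forall fun b =>
    isClosed_setOf_forall fun c => ?_) (isClosed_setOf_forall fun a =>
    isClosed_setOf_forall fun k => isClosed_setOf_forall fun m => ?_)))
  · exact isClosed_eq_of_isRegularAt (fun z => SpaceWithFunctions.mul _ (hr _ z) (hr _ z))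
      (fun z => SpaceWithFunctions.mul _ (hr _ z) (hr _ z))
  · exact isClosed_eq_of_isRegularAt (fun z => SpaceWithFunctions.mul _ (hr _ z) (hr _ z))
      (fun z => SpaceWithFunctions.mul _ (hr _ z) (hr _ z))
  · exact isClosed_eq_of_isRegularAt (hr _) (hr _)
  · exact isClosed_eq_zero fun z => SpaceWithFunctions.add _ (.sum fun i _ => hr _ z)
      (.sum fun i _ => hr _ z)

theorem weightedSetoid_one_iff {z z' : Fin (N + 1) → ℂ} :
    weightedSetoid (unitWeights N) z z' ↔ ∃ t : ℂˣ, z' = t • z := by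
  refine exists_congr fun t => ?_
  rw [funext_iff]
  simp [Units.smul_def]

theorem segreEquations_smul {z : Fin (N + 1) → ℂ} (t : ℂˣ) (h : SegreEquations (z ∘ e)) :
    SegreEquations ((t • z) ∘ e) := by
  obtain ⟨h1, h2, h3, h4⟩ := h
  simp only [Function.comp_apply] at h1 h2 h3 h4
  refine ⟨fun a b k => ?_, fun a b c k => ?_, fun a b c => ?_, fun a k m => ?_⟩ <;>
    simp only [Function.comp_apply, Pi.smul_apply, Units.smul_def, smul_eq_mul]
  · linear_combination (t : ℂ) ^ 2 * h1 a b k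
  · linear_combination (t : ℂ) ^ 2 * h2 a b c k
  · rw [h3]
  · rw [← Finset.mul_sum, ← Finset.mul_sum, ← mul_add, h4, mul_zero]

theorem linearIndependent_segreI_smul {z : Fin (N + 1) → ℂ} (t : ℂˣ)
    (h : LinearIndependent ℂ (segreI (z ∘ e)).row) :
    LinearIndependent ℂ (segreI ((t • z) ∘ e)).row :=
  h.units_smul fun _ => t

/-- Both the rank condition (open) and the Segre equations (closed) are invariant under scaling, so
they descend to projective space. Conversely, a point satisfying them has some $y_{(0,i)}\ne0$ and
is rebuilt from its normalized coordinates. -/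
theorem isLocallyClosed_range_segreEmbedding :
    IsLocallyClosed (Set.range (segreEmbedding (d := d) (r := r) e)) := by
  have hU : ∀ (z : Fin (N + 1) → ℂ) (hz : z ≠ 0),
      weightedProjectiveSpace.mk (unitWeights N) z hz ∈ {p : (weightedProjectiveSpace (unitWeights N)).carrier |
        ∃ z hz, weightedProjectiveSpace.mk (unitWeights N) z hz = p ∧ LinearIndependent ℂ (segreI (z ∘ e)).row} ↔
      LinearIndependent ℂ (segreI (z ∘ e)).row := by
    refine fun z hz => ⟨?_, fun h => ⟨z, hz, rfl, h⟩⟩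
    rintro ⟨z', hz', h, hL⟩
    obtain ⟨t, rfl⟩ := weightedSetoid_one_iff.1 (weightedProjectiveSpace.mk_eq_mk.1 h)
    exact linearIndependent_segreI_smul e t hL
  have hC : ∀ (z : Fin (N + 1) → ℂ) (hz : z ≠ 0),
      weightedProjectiveSpace.mk (unitWeights N) z hz ∈ {p : (weightedProjectiveSpace (unitWeights N)).carrier |
        ∃ z hz, weightedProjectiveSpace.mk (unitWeights N) z hz = p ∧ SegreEquations (z ∘ e)} ↔
      SegreEquations (z ∘ e) := by
    refine fun z hz => ⟨?_, fun h => ⟨z, hz, rfl, h⟩⟩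
    rintro ⟨z', hz', h, hE⟩
    obtain ⟨t, rfl⟩ := weightedSetoid_one_iff.1 (weightedProjectiveSpace.mk_eq_mk.1 h)
    exact segreEquations_smul e t hE
  refine ⟨_, _, weightedProjectiveSpace.isOpen_of_isOpen (isOpen_linearIndependent
    (Z := affineSpace (Fin (N + 1) → ℂ)) fun z k i => isRegularAt_apply (e (Sum.inl (k, i))) z) hU,
    weightedProjectiveSpace.isClosed_of_isClosed (isClosed_segreEquations e) hC, ?_⟩
  ext p
  constructor
  · rintro ⟨q, rfl⟩
    obtain ⟨u, v, hv, rfl⟩ := moduliGS.exists_ofPair q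
    rw [segreEmbedding_ofPair]
    have hs : (segre u v ∘ e.symm) ∘ e = segre u v := by
      funext i
      simp
    refine ⟨(hU _ _).2 ?_, (hC _ _).2 ?_⟩
    · rw [hs]
      exact hv.2
    · rw [hs]
      exact segreEquations_segre u hv.1
  · rintro ⟨hp1, hp2⟩
    obtain ⟨z, hz, rfl⟩ := weightedProjectiveSpace.exists_mk p
    obtain ⟨i, hi⟩ := Function.ne_iff.1 (((hU z hz).1 hp1).ne_zero 0)
    obtain ⟨h1, h2⟩ := weightedProjectiveSpace.mk_chartSection (hw := one_weights N)
      (a := e (Sum.inl (0, i))) (q := weightedProjectiveSpace.mk (unitWeights N) z hz)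
      ((segreChart_mk_ne e (a := (0, i)) (hz := hz)).2 hi)
    have ha : segreChart e (0, i) (weightedProjectiveSpace.mk (unitWeights N) z hz) (Sum.inl (0, i)) = 1 :=
        weightedProjectiveSpace.chartSection_self (hw := one_weights N) (a := e (Sum.inl (0, i)))
        (q := weightedProjectiveSpace.mk (unitWeights N) z hz) ((segreChart_mk_ne e).2 hi)
    rw [← h2] at hp1 hp2
    have hE : SegreEquations (segreChart e (0, i) (weightedProjectiveSpace.mk (unitWeights N) z hz)) :=
      (hC _ _).1 hp2
    refine ⟨moduliGS.ofPair (unsegreFst (0, i) (segreChart e (0, i)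
      (weightedProjectiveSpace.mk (unitWeights N) z hz))) _ (unsegreSnd_mem hE ((hU _ _).1 hp1) ha), ?_⟩
    rw [segreEmbedding_ofPair]
    refine Eq.trans ?_ h2
    congr 1
    rw [segre_unsegre hE ha]
    funext j
    simp [segreChart_apply]

end Embedding

/-! ### Quasi-projectivity, emptiness and dimension -/

theorem isQuasiProjectiveVariety_moduliGS (h : d < r) :
    (moduliGS d r 1).IsQuasiProjectiveVariety := by
  refine ⟨irreducibleSpace_moduliGS h, ?_⟩
  have hpos : Fintype.card (SegreIndex d r) ≠ 0 := by
    have : Nonempty (SegreIndex d r) := ⟨Sum.inl (0, ⟨d, h⟩)⟩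
    exact Fintype.card_ne_zero
  obtain ⟨N, hN⟩ := Nat.exists_eq_succ_of_ne_zero hpos
  let e := Fintype.equivFinOfCardEq hN
  exact ⟨N, _, isLocallyClosed_range_segreEmbedding e, ⟨moduliGSSegreIso e⟩⟩

theorem isEmpty_moduliGS (h : r ≤ d) : IsEmpty (moduliGS d r 1).carrier := by
  refine ⟨fun q => ?_⟩
  obtain ⟨u, v, hv, rfl⟩ := moduliGS.exists_ofPair q
  have := hv.2.fintype_card_le_finrank
  simp only [Fintype.card_fin, Module.finrank_fintype_fun_eq_card] at this
  omega

theorem exists_topologicalKrullDim_moduliGS (h : d < r) :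
    ∃ n : ℕ, topologicalKrullDim (moduliGS d r 1).carrier = n ∧
      (n : ℚ) = 2 * (d + 1) * r - d * (d - 1) / 2 := by
  have := (irreducibleSpace_moduliGS h).toNonempty
  refine ⟨_, isLocallyAffine_moduliGS.topologicalKrullDim_eq, ?_⟩
  -- Ensures that the subtraction of natural numbers in the dimension is not truncated; $d<r$ enters
  -- here.
  have hc : (d + 2).choose 2 + 1 ≤ 2 * (d + 1) + 2 * ((d + 1) * r) := by
    have h1 : 2 * (d + 2).choose 2 ≤ (d + 2) * (d + 1) := by
      rw [Nat.choose_two_right]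
      exact Nat.mul_div_le _ _
    nlinarith
  have h2 := Nat.cast_choose_two ℚ (d + 2)
  rw [Nat.sub_sub, Nat.cast_sub (by omega)]
  push_cast at h2 ⊢
  rw [h2]
  ring

end ADHM

/-- The moduli space of globally stable charge-one data is empty for `r ≤ d`; for `r > d` it is a
nonsingular quasi-projective variety of dimension `2(d+1)r - d(d-1)/2`, and
`[A, B, I, J] ↦ ((A, B), [I, J])` identifies it with the product of `ℂ^(2(d+1))` and the open set of
solutions with linearly independent `I_k` in a weighted projective space. -/
theorem proposition4p1 (d r : ℕ) :
    (r ≤ d → IsEmpty (ADHM.moduliGS d r 1).carrier) ∧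
    (d < r →
      (ADHM.moduliGS d r 1).IsQuasiProjectiveVariety ∧
      (ADHM.moduliGS d r 1).IsNonsingular ∧
      (∃ n : ℕ, topologicalKrullDim (ADHM.moduliGS d r 1).carrier = n ∧
        (n : ℚ) = 2 * (d + 1) * r - d * (d - 1) / 2) ∧
      (∃ U : Set (ADHM.pairSpace d r).carrier, IsOpen U ∧
        ADHM.independentPairSolutions d r = ADHM.pairSolutions d r ∩ U) ∧
      ∃ Φ : (ADHM.moduliGS d r 1).Iso (ADHM.chargeOneModel d r),
        ∀ (X : ADHM.Datum d r 1) (hX : X ∈ ADHM.globallyStableSolutions d r 1),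
          (Φ.toHomeomorph (ADHM.moduliGS.mk X hX)).1 = ADHM.abCoords X ∧
          ∃ hv : ADHM.ijCoords X ≠ 0,
            ((Φ.toHomeomorph (ADHM.moduliGS.mk X hX)).2).1 =
              SpaceWithFunctions.weightedProjectiveSpace.mk (ADHM.pairWeights d r)
                (ADHM.ijCoords X) hv) :=
  ⟨ADHM.isEmpty_moduliGS, fun h => ⟨ADHM.isQuasiProjectiveVariety_moduliGS h,
    ADHM.isLocallyAffine_moduliGS.isNonsingular, ADHM.exists_topologicalKrullDim_moduliGS h,
    ADHM.independentPairSolutions_eq_inter, ADHM.moduliGSIso d r, fun _ hX =>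
      ⟨rfl, ADHM.moduliGS.ijCoords_ne_zero hX, rfl⟩⟩⟩
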